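/- Work over $\mathbb{Z}[q,q^{-1}]$, and put $[n]_q=\frac{q^n-q^{-n}}{q-q^{-1}}$ and $[n]_q^!=[n]_q[n-1]_q\cdots[1]_q$. Let $\mathcal O_q(n)$ be Manin's quantized coordinate algebra: the $\mathbb{Z}[q,q^{-1}]$-algebra on generators $x_{i,j}$ $(1\le i,j\le n)$ with relations $x_{i,j}x_{k,l}=x_{k,l}x_{i,j}$ if $i<k,\ j>l$; $x_{i,j}x_{k,l}=x_{k,l}x_{i,j}-(q-q^{-1})x_{i,l}x_{k,j}$ if $i>k,\ j>l$; $x_{i,j}x_{i,l}=q^{-1}x_{i,l}x_{i,j}$ if $j>l$; $x_{i,j}x_{k,j}=q\,x_{k,j}x_{i,j}$ if $i<k$. Its comultiplication is $\Delta(x_{i,k})=\sum_j x_{i,j}\otimes x_{j,k}$. It has a basis of normally-ordered monomials $x_A=\prod_{j=1}^{n}\bigl(x_{n,j}^{a_{n,j}}\cdots x_{1,j}^{a_{1,j}}\bigr)$ (factors taken in the order $j=1,\dots,n$), indexed by the $n\times n$ matrices $A$ of non-negative integers. Let $Z(A,B,C)$ be the coefficient of $x_A\otimes x_B$ in $\Delta(x_C)$;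 for non-square matrices, first add rows and columns of zeros to make all three $n\times n$ for a common $n$. The $q$-Schur category (with $0$-strings) has as objects all compositions, i.e. finite sequences of non-negative integers. The morphism space $\operatorname{Hom}(\mu,\lambda)$ is the free $\mathbb{Z}[q,q^{-1}]$-module with standard basis $\{\xi_A\}$, where $A$ runs over the matrices of non-negative integers with row sums $\lambda$ and column sums $\mu$. Composition is $\xi_A\circ\xi_B=\sum_C Z(A,B,C)\,\xi_C$. The tensor product $\star$ is concatenation on objects and $\xi_A\star\xi_B=\xi_{\operatorname{diag}(A,B)}$ on morphisms. The merge $(a,b)\to(a+b)$ is $\xi_{[a\ b]}$, the split $(a+b)\to(a,b)$ is $\xi_{\left[\begin{smallmatrix}a\\b\end{smallmatrix}\right]}$, and the positive crossing $(a,b)\to(b,a)$ is $X_{a,b}:=\xi_{\left[\begin{smallmatrix}0&b\\a&0\end{smallmatrix}\right]}$. For $0\le s\le\min(a,b)$, let $D_s:(a,b)\to(a,b)$ be the double coset diagram with cross strands of thickness $s$. That is, the two strings split as $(a,b)\to(a-s,s,s,b-s)$, the two inner strings of thickness $s$ cross by the positive crossing $X_{s,s}$, and the strings then merge as $(a-s,s,s,b-s)\to(a,b)$.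 **Corollary.** For all integers $a,b\ge 0$, $$X_{b,a}\circ X_{a,b}=\sum_{s=0}^{\min(a,b)}q^{-s(s-1)/2-s(a+b-2s)}\,(q^{-1}-q)^s\,[s]_q^!\;D_s ,$$ where $D_s$ is the standard basis element $\xi_{\left[\begin{smallmatrix}a-s&s\\s&b-s\end{smallmatrix}\right]}$ for each $s$. -/

import Mathlib

open scoped TensorProduct

noncomputable section

namespace QSchur

/-! ### The ground ring `ℤ[q, q⁻¹]` -/

/-- The ground ring `ℤ[q, q⁻¹]`. -/
abbrev Zq : Type := LaurentPolynomial ℤ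

/-- The power `q ^ k`, for an integer `k`. -/
abbrev qpow (k : ℤ) : Zq := LaurentPolynomial.T k

/-- The element `q - q⁻¹`. -/
abbrev hq : Zq := qpow 1 - qpow (-1)

/-- The quantum integer `[n]_q = (q ^ n - q ^ (-n)) / (q - q⁻¹)`, written as the Laurent polynomial
`q ^ (n - 1) + q ^ (n - 3) + ⋯ + q ^ (1 - n)`. -/
def qInt (n : ℕ) : Zq := ∑ k ∈ Finset.range n, qpow ((n : ℤ) - 1 - 2 * k)

/-- The defining property of the quantum integer. -/
theorem hq_mul_qInt (n : ℕ) : hq * qInt n = qpow n - qpow (-n) := by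
  have key : ∀ m : ℕ, hq * ∑ k ∈ Finset.range m, qpow ((n : ℤ) - 1 - 2 * k)
      = qpow n - qpow ((n : ℤ) - 2 * m) := by
    intro m
    induction m with
    | zero => simp
    | succ m ih =>
      rw [Finset.sum_range_succ, mul_add, ih, sub_mul, ← LaurentPolynomial.T_add,
        ← LaurentPolynomial.T_add]
      have h1 : (1 : ℤ) + ((n : ℤ) - 1 - 2 * m) = n - 2 * m := by ring
      have h2 : (-1 : ℤ) + ((n : ℤ) - 1 - 2 * m) = n - 2 * ((m + 1 : ℕ) : ℤ) := by
        push_cast; ring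
      rw [h1, h2]; abel
  have h := key n
  rwa [show (n : ℤ) - 2 * n = -n by ring] at h

/-- The quantum factorial `[n]_q! = [n]_q [n-1]_q ⋯ [1]_q`. -/
def qFactorial (n : ℕ) : Zq := ∏ k ∈ Finset.range n, qInt (k + 1)

/-! ### Manin's quantized coordinate algebra of `n × n` matrices -/

/-- The entries of the `n × n` array `x` satisfy the defining relations of Manin's quantized
coordinate algebra. -/
structure IsManin {n : ℕ} {A : Type*} [Ring A] [Algebra Zq A] (x : Fin n → Fin n → A) :
    Prop where
  comm : ∀ i k j l, i < k → l < j → x i j * x k l = x k l * x i j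
  cross : ∀ i k j l, k < i → l < j → x i j * x k l = x k l * x i j - hq • (x i l * x k j)
  row : ∀ i j l, l < j → x i j * x i l = qpow (-1) • (x i l * x i j)
  col : ∀ i k j, i < k → x i j * x k j = qpow 1 • (x k j * x i j)

/-- The defining relations on the free algebra on generators `x_{i,j}`. -/
inductive ManinRel (n : ℕ) :
    FreeAlgebra Zq (Fin n × Fin n) → FreeAlgebra Zq (Fin n × Fin n) → Prop
  | comm (i k j l : Fin n) : i < k → l < j →
      ManinRel n (FreeAlgebra.ι Zq (i, j) * FreeAlgebra.ι Zq (k, l))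
        (FreeAlgebra.ι Zq (k, l) * FreeAlgebra.ι Zq (i, j))
  | cross (i k j l : Fin n) : k < i → l < j →
      ManinRel n (FreeAlgebra.ι Zq (i, j) * FreeAlgebra.ι Zq (k, l))
        (FreeAlgebra.ι Zq (k, l) * FreeAlgebra.ι Zq (i, j)
          - hq • (FreeAlgebra.ι Zq (i, l) * FreeAlgebra.ι Zq (k, j)))
  | row (i j l : Fin n) : l < j →
      ManinRel n (FreeAlgebra.ι Zq (i, j) * FreeAlgebra.ι Zq (i, l))
        (qpow (-1) • (FreeAlgebra.ι Zq (i, l) * FreeAlgebra.ι Zq (i, j)))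
  | col (i k j : Fin n) : i < k →
      ManinRel n (FreeAlgebra.ι Zq (i, j) * FreeAlgebra.ι Zq (k, j))
        (qpow 1 • (FreeAlgebra.ι Zq (k, j) * FreeAlgebra.ι Zq (i, j)))

/-- Manin's quantized coordinate algebra `𝒪_q(n)` over `ℤ[q, q⁻¹]`. -/
def Oq (n : ℕ) : Type := RingQuot (ManinRel n)

instance (n : ℕ) : Ring (Oq n) := inferInstanceAs (Ring (RingQuot (ManinRel n)))

instance (n : ℕ) : Algebra Zq (Oq n) := inferInstanceAs (Algebra Zq (RingQuot (ManinRel n)))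

/-- The quotient map from the free algebra. -/
def Oq.mk (n : ℕ) : FreeAlgebra Zq (Fin n × Fin n) →ₐ[Zq] Oq n :=
  RingQuot.mkAlgHom Zq (ManinRel n)

theorem Oq.mk_rel {n : ℕ} {x y : FreeAlgebra Zq (Fin n × Fin n)} (h : ManinRel n x y) :
    Oq.mk n x = Oq.mk n y :=
  RingQuot.mkAlgHom_rel Zq h

/-- The generator `x_{i,j}` of `𝒪_q(n)`. -/
def gen {n : ℕ} (i j : Fin n) : Oq n :=
  Oq.mk n (FreeAlgebra.ι Zq (i, j))

theorem isManin_gen (n : ℕ) : IsManin (gen (n := n)) where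
  comm i k j l h h' := by
    simpa [gen] using Oq.mk_rel (ManinRel.comm i k j l h h')
  cross i k j l h h' := by
    simpa only [gen, map_mul, map_sub, map_smul] using
      Oq.mk_rel (ManinRel.cross i k j l h h')
  row i j l h := by
    simpa only [gen, map_mul, map_sub, map_smul] using
      Oq.mk_rel (ManinRel.row i j l h)
  col i k j h := by
    simpa only [gen, map_mul, map_sub, map_smul] using
      Oq.mk_rel (ManinRel.col i k j h)

/-- The universal property of `𝒪_q(n)`. -/
def Oq.lift {n : ℕ} {A : Type*} [Ring A] [Algebra Zq A] (x : Fin n → Fin n → A)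
    (hx : IsManin x) : Oq n →ₐ[Zq] A :=
  RingQuot.liftAlgHom Zq (s := ManinRel n)
    ⟨FreeAlgebra.lift Zq fun p => x p.1 p.2, by
      intro a b h
      cases h with
      | comm i k j l h h' => simpa using hx.comm i k j l h h'
      | cross i k j l h h' =>
        simpa only [map_mul, map_sub, map_smul, FreeAlgebra.lift_ι_apply] using
          hx.cross i k j l h h'
      | row i j l h =>
        simpa only [map_mul, map_sub, map_smul, FreeAlgebra.lift_ι_apply] using hx.row i j l h
      | col i k j h =>
        simpa only [map_mul, map_sub, map_smul, FreeAlgebra.lift_ι_apply] using hx.col i k j h⟩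

theorem Oq.lift_gen {n : ℕ} {A : Type*} [Ring A] [Algebra Zq A] (x : Fin n → Fin n → A)
    (hx : IsManin x) (i j : Fin n) : Oq.lift x hx (gen i j) = x i j := by
  exact (RingQuot.liftAlgHom_mkAlgHom_apply Zq _ _ _).trans (by simp)

/-- Two double sums agree if their diagonal terms and the sums of their transposed pairs of terms
agree. -/
theorem sum_sum_congr_pairs {n : ℕ} {M : Type*} [AddCommMonoid M] (F G : Fin n → Fin n → M)
    (hd : ∀ p, F p p = G p p) (ho : ∀ p m, p < m → F p m + F m p = G p m + G m p) :
    ∑ p, ∑ m, F p m = ∑ p, ∑ m, G p m := by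
  have key : ∀ H : Fin n → Fin n → M, ∑ p, ∑ m, H p m
      = ∑ p, H p p + ∑ p, ∑ m, (if p < m then H p m + H m p else 0) := by
    intro H
    have h1 : ∀ p m, H p m = (if p = m then H p p else 0)
        + ((if p < m then H p m else 0) + (if m < p then H p m else 0)) := by
      intro p m
      rcases lt_trichotomy p m with h | h | h
      · simp [h, h.ne, h.not_gt]
      · subst h; simp
      · simp [h, h.ne', h.not_gt]
    have h2 : ∑ p, ∑ m, (if m < p then H p m else 0)
        = ∑ p, ∑ m, (if p < m then H m p else 0) := Finset.sum_comm
    have h3 : ∀ p m, (if p < m then H p m + H m p else 0)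
        = (if p < m then H p m else 0) + (if p < m then H m p else 0) := by
      intro p m; split_ifs <;> simp
    rw [Finset.sum_congr rfl fun p _ => Finset.sum_congr rfl fun m _ => h1 p m]
    simp only [h3, Finset.sum_add_distrib, h2, Finset.sum_ite_eq, Finset.mem_univ, if_true]
  rw [key F, key G]
  congr 1
  · exact Finset.sum_congr rfl fun p _ => hd p
  · refine Finset.sum_congr rfl fun p _ => Finset.sum_congr rfl fun m _ => ?_
    split_ifs with h
    · exact ho p m h
    · rfl

/-- The matrix product, with entries in a tensor product, of two copies of an array satisfying
Manin's relations again satisfies Manin's relations. -/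
theorem IsManin.comul {n : ℕ} {A : Type*} [Ring A] [Algebra Zq A] {x : Fin n → Fin n → A}
    (hx : IsManin x) : IsManin fun i j => ∑ p, x i p ⊗ₜ[Zq] x p j := by
  have hinv : qpow 1 * qpow (-1) = (1 : Zq) := by
    rw [← LaurentPolynomial.T_add]; simp
  have hprod : ∀ i j k l, (∑ p, x i p ⊗ₜ[Zq] x p j) * (∑ p, x k p ⊗ₜ[Zq] x p l)
      = ∑ p, ∑ m, (x i p * x k m) ⊗ₜ[Zq] (x p j * x m l) := by
    intro i j k l
    simp only [Finset.sum_mul_sum, Algebra.TensorProduct.tmul_mul_tmul]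
  constructor
  · intro i k j l hik hlj
    simp only [hprod]
    refine sum_sum_congr_pairs _ _ (fun p => ?_) (fun p m hpm => ?_)
    · rw [hx.col i k p hik, hx.row p j l hlj]
      simp only [← TensorProduct.smul_tmul', TensorProduct.tmul_smul, smul_smul]
      match_scalars
      linear_combination hinv
    · rw [hx.comm p m j l hpm hlj, hx.cross m p j l hpm hlj, hx.comm i k m p hik hpm,
        hx.cross k i m p hik hpm]
      simp only [TensorProduct.sub_tmul, TensorProduct.tmul_sub, ← TensorProduct.smul_tmul',
        TensorProduct.tmul_smul]
      module
  · intro i k j l hki hlj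
    simp only [hprod, Finset.smul_sum, ← Finset.sum_sub_distrib]
    refine sum_sum_congr_pairs _ _ (fun p => ?_) (fun p m hpm => ?_)
    · rw [hx.col k i p hki, hx.row p j l hlj]
      simp only [← TensorProduct.smul_tmul', TensorProduct.tmul_smul]
      match_scalars
      simp only [hq]
      ring
    · rw [hx.cross i k m p hki hpm, hx.cross m p j l hpm hlj, hx.comm k i m p hki hpm,
        hx.comm p m j l hpm hlj]
      simp only [TensorProduct.sub_tmul, TensorProduct.tmul_sub, ← TensorProduct.smul_tmul',
        TensorProduct.tmul_smul]
      module
  · intro i j l hlj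
    simp only [hprod, Finset.smul_sum]
    refine sum_sum_congr_pairs _ _ (fun p => ?_) (fun p m hpm => ?_)
    · rw [hx.row p j l hlj]
      simp only [TensorProduct.tmul_smul]
    · rw [hx.row i m p hpm, hx.cross m p j l hpm hlj, hx.comm p m j l hpm hlj]
      simp only [TensorProduct.tmul_sub, ← TensorProduct.smul_tmul',
        TensorProduct.tmul_smul]
      match_scalars
      · simp only [hq]
        linear_combination -hinv
      · ring
  · intro i k j hik
    simp only [hprod, Finset.smul_sum]
    refine sum_sum_congr_pairs _ _ (fun p => ?_) (fun p m hpm => ?_)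
    · rw [hx.col i k p hik]
      simp only [← TensorProduct.smul_tmul']
    · rw [hx.col p m j hpm, hx.comm i k m p hik hpm, hx.cross k i m p hik hpm]
      simp only [TensorProduct.sub_tmul, ← TensorProduct.smul_tmul',
        TensorProduct.tmul_smul]
      match_scalars
      · ring
      · simp only [hq]
        linear_combination -hinv

/-- The comultiplication `x_{i,j} ↦ ∑_p x_{i,p} ⊗ x_{p,j}` of `𝒪_q(n)`. -/
def comul (n : ℕ) : Oq n →ₐ[Zq] Oq n ⊗[Zq] Oq n :=
  Oq.lift (fun i j => ∑ p, gen i p ⊗ₜ[Zq] gen p j) (isManin_gen n).comul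

/-- The normally-ordered monomial `x_A`: the columns appear from left to right in increasing order,
and the row indices decrease from left to right within each column, so that
`x_A = ∏_{j = 1, …, n} (∏_{i = n, …, 1} x_{i,j} ^ a_{i,j})`. -/
def normalMonomial {n : ℕ} (A : Matrix (Fin n) (Fin n) ℕ) : Oq n :=
  ((List.finRange n).map fun j =>
    ((List.finRange n).reverse.map fun i => gen i j ^ A i j).prod).prod

open Classical in
/-- The standard basis element `ξ_A` of the `q`-Schur algebra, as a linear functional on `𝒪_q(n)`:
the member indexed by `A` of the basis dual to the normally-ordered monomials `x_B`. (As these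
monomials form a basis of `𝒪_q(n)`, there is precisely one such functional.) -/
def dualMonomial {n : ℕ} (A : Matrix (Fin n) (Fin n) ℕ) : Oq n →ₗ[Zq] Zq :=
  if h : ∃ f : Oq n →ₗ[Zq] Zq, ∀ B, f (normalMonomial B) = if B = A then 1 else 0 then h.choose
  else 0

/-- The structure constant `Z(A, B, C) = ⟨ξ_A ⊗ ξ_B, Δ(x_C)⟩` of the `q`-Schur algebra. -/
def structConst {n : ℕ} (A B C : Matrix (Fin n) (Fin n) ℕ) : Zq :=
  LinearMap.mul' Zq Zq
    (TensorProduct.map (dualMonomial A) (dualMonomial B) (comul n (normalMonomial C)))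

/-! ### The `q`-Schur category

Objects are compositions, i.e. lists of natural numbers (zero parts are allowed), with tensor product
given by concatenation. -/

/-- `Mat(lam, mu)`: matrices of natural numbers with row sums `lam` and column sums `mu`. -/
def Mat (lam mu : List ℕ) : Type :=
  {A : Matrix (Fin lam.length) (Fin mu.length) ℕ //
    (∀ i, ∑ j, A i j = lam.get i) ∧ ∀ j, ∑ i, A i j = mu.get j}

instance (lam mu : List ℕ) : Finite (Mat lam mu) := by
  refine Finite.of_injective
    (β := Fin lam.length → Fin mu.length → Fin (lam.sum + 1))
    (fun A i j => ⟨A.1 i j, Nat.lt_succ_of_le ?_⟩) ?_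
  · calc A.1 i j ≤ ∑ j, A.1 i j := Finset.single_le_sum (f := fun j => A.1 i j)
          (fun _ _ => Nat.zero_le _) (Finset.mem_univ j)
      _ = lam.get i := A.2.1 i
      _ ≤ lam.sum := List.le_sum_of_mem (List.get_mem lam i)
  · intro A B h
    apply Subtype.ext
    funext i j
    simpa using congrFun (congrFun h i) j

instance (lam mu : List ℕ) : Fintype (Mat lam mu) := Fintype.ofFinite _

/-- The `n × n` matrix obtained from `A` by appending rows and columns of zeros. -/
def Mat.pad {lam mu : List ℕ} (A : Mat lam mu) (n : ℕ) : Matrix (Fin n) (Fin n) ℕ :=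
  fun i j => if h : (i : ℕ) < lam.length ∧ (j : ℕ) < mu.length then A.1 ⟨i, h.1⟩ ⟨j, h.2⟩ else 0

/-- The morphism space from `mu` to `lam`: the free `ℤ[q, q⁻¹]`-module with basis `Mat(lam, mu)`
(so it is zero if `mu` and `lam` have different sums). -/
abbrev Hom (mu lam : List ℕ) : Type := Mat lam mu →₀ Zq

/-- The standard basis vector `ξ_A`. -/
def xi {lam mu : List ℕ} (A : Mat lam mu) : Hom mu lam := Finsupp.single A 1

/-- The structure constant `Z(A, B, C)` for matrices that need not be square: enlarge the matrices
by zero rows and columns to a common square format. -/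
def Z {lam mu nu : List ℕ} (A : Mat lam mu) (B : Mat mu nu) (C : Mat lam nu) : Zq :=
  let n := max lam.length (max mu.length nu.length)
  structConst (A.pad n) (B.pad n) (C.pad n)

/-- Vertical composition `f ∘ g`, the bilinear extension of `ξ_A ∘ ξ_B = ∑_C Z(A, B, C) ξ_C`. -/
def comp {lam mu nu : List ℕ} (f : Hom mu lam) (g : Hom nu mu) : Hom nu lam :=
  f.sum fun A x => g.sum fun B y => (x * y) • ∑ C : Mat lam nu, Z A B C • xi C

/-- Identification of the rows of a block matrix. -/
def blockEquiv (l l' : List ℕ) : Fin l.length ⊕ Fin l'.length ≃ Fin (l ++ l').length :=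
  finSumFinEquiv.trans (finCongr List.length_append.symm)

/-- The block diagonal matrix `diag(A, B)`. -/
def Mat.diag {lam mu sig rho : List ℕ} (A : Mat lam mu) (B : Mat sig rho) :
    Mat (lam ++ sig) (mu ++ rho) :=
  ⟨Matrix.reindex (blockEquiv lam sig) (blockEquiv mu rho) (Matrix.fromBlocks A.1 0 0 B.1), by
    constructor
    · intro i
      obtain ⟨i, rfl⟩ := (blockEquiv lam sig).surjective i
      rw [← Equiv.sum_comp (blockEquiv mu rho)]
      rcases i with i | i
      · simp [A.2.1, blockEquiv]
      · simp [B.2.1, blockEquiv]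
    · intro j
      obtain ⟨j, rfl⟩ := (blockEquiv mu rho).surjective j
      rw [← Equiv.sum_comp (blockEquiv lam sig)]
      rcases j with j | j
      · simp [A.2.2, blockEquiv]
      · simp [B.2.2, blockEquiv]⟩

/-- Horizontal composition `f ⋆ g`, the bilinear extension of `ξ_A ⋆ ξ_B = ξ_{diag(A, B)}`. -/
def star {lam mu sig rho : List ℕ} (f : Hom mu lam) (g : Hom rho sig) :
    Hom (mu ++ rho) (lam ++ sig) :=
  f.sum fun A x => g.sum fun B y => (x * y) • xi (A.diag B)

/-- The identity endomorphism `1_lam = ξ_{diag(lam_1, …, lam_ℓ)}`. -/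
def idHom (lam : List ℕ) : Hom lam lam :=
  xi ⟨Matrix.diagonal lam.get, by simp [Matrix.diagonal_apply]⟩

/-! ### The generating morphisms -/

/-- The merge `(a, b) → (c)`, where `a + b = c`. -/
def merge (a b c : ℕ) (h : a + b = c) : Hom [a, b] [c] :=
  xi (lam := [c]) (mu := [a, b]) ⟨!![a, b], by
    constructor
    · intro i; fin_cases i; simpa [Fin.sum_univ_succ] using h
    · intro j; fin_cases j <;> simp⟩

/-- The split `(c) → (a, b)`, where `a + b = c`. -/
def split (a b c : ℕ) (h : a + b = c) : Hom [c] [a, b] :=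
  xi (lam := [a, b]) (mu := [c]) ⟨!![a; b], by
    constructor
    · intro i; fin_cases i <;> simp
    · intro j; fin_cases j; simpa [Fin.sum_univ_succ] using h⟩

/-- The positive crossing `(a, b) → (b, a)`. -/
def crossing (a b : ℕ) : Hom [a, b] [b, a] :=
  xi (lam := [b, a]) (mu := [a, b]) ⟨!![0, b; a, 0], by
    constructor
    · intro i; fin_cases i <;> simp [Fin.sum_univ_succ]
    · intro j; fin_cases j <;> simp [Fin.sum_univ_succ]⟩

/-- The matrix with rows `(a - s, s)` and `(s, b - s)`. -/
def crossMat (a b s : ℕ) (h : s ≤ min a b) : Mat [a, b] [a, b] :=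
  ⟨!![a - s, s; s, b - s], by
    have ha : s ≤ a := h.trans (min_le_left a b)
    have hb : s ≤ b := h.trans (min_le_right a b)
    constructor
    · intro i; fin_cases i <;> simp [Fin.sum_univ_succ] <;> omega
    · intro j; fin_cases j <;> simp [Fin.sum_univ_succ] <;> omega⟩

/-- The double coset diagram from `(a, b)` to `(a, b)` with two cross strands of thickness `s`, read
from bottom to top: both strings split, `(a, b) → (a - s, s, s, b - s)`, then the two inner strings
of thickness `s` cross positively, and then the strings merge, `(a - s, s, s, b - s) → (a, b)`. -/
def crossDiagram (a b s : ℕ) (h : s ≤ min a b) : Hom [a, b] [a, b] :=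
  have ha : a - s + s = a := Nat.sub_add_cancel (h.trans (min_le_left a b))
  have hb : s + (b - s) = b := Nat.add_sub_cancel' (h.trans (min_le_right a b))
  comp (lam := [a, b]) (mu := [a - s, s, s, b - s]) (nu := [a, b])
    (star (merge (a - s) s a ha) (merge s (b - s) b hb))
    (comp (lam := [a - s, s, s, b - s]) (mu := [a - s, s, s, b - s]) (nu := [a, b])
      (star (idHom [a - s]) (star (crossing s s) (idHom [b - s])))
      (star (split (a - s) s a ha) (split s (b - s) b hb)))

end QSchur

end

/-!
The structure constants of composition are coefficients in `𝒪_q(n) ⊗ 𝒪_q(n)`, which is hard to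
compute in directly. But normally ordered monomials span `𝒪_q(n)`, so a linear functional on it is
determined by its values on them: if an array `x` of elements of some algebra satisfies Manin's
relations, and a functional `f` of that algebra takes the value `1` on the monomial `x_A` and `0` on
all the others, then the functional dual to the basis element `x_A` is `f` precomposed with the
homomorphism sending the generators to `x`. Comultiplication becomes matrix multiplication of
arrays, so every structure constant can be read off from two such realizations.

Crossings are realized by the `q`-oscillator, with the raising, lowering and number operators as
matrix entries, and merges and splits by skew variables. In the product of two crossings the only
surviving term is the vacuum expectation value of `lower ^ s * number ^ m * raise ^ s`, which gives
the coefficient `q ^ (-s (s - 1) / 2 - s m) (q⁻¹ - q) ^ s [s]!`. In the double coset diagrams the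
normally ordered monomials of the product array are again dual to a single matrix.
-/

noncomputable section

namespace QSchur

section OrderedProducts

open Submodule

variable {R A ι κ : Type*} [CommSemiring R] [Semiring A] [Algebra R A]

theorem span_mul_adjoin_le {s t : Set A} (h : span R s * span R t ≤ span R t * span R s) :
    span R s * (Algebra.adjoin R t).toSubmodule ≤ (Algebra.adjoin R t).toSubmodule * span R s := by
  refine mul_le.2 fun v hv x hx => ?_
  replace hx : x ∈ Algebra.adjoin R t := hx
  induction hx using Algebra.adjoin_induction generalizing v with
  | mem x hx =>
    exact mul_le_mul_left (span_le.2 Algebra.subset_adjoin) _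
      (h (mul_mem_mul hv (subset_span hx)))
  | algebraMap r =>
    rw [← Algebra.commutes]
    exact mul_mem_mul (Subalgebra.algebraMap_mem _ r) hv
  | add x y _ _ hx hy =>
    rw [mul_add]
    exact add_mem (hx v hv) (hy v hv)
  | mul x y _ _ hx hy =>
    rw [← mul_assoc]
    refine Submodule.mul_induction_on (hx v hv) (fun a ha w hw => ?_) fun a b ha hb => ?_
    · have := mul_mem_mul ha (hy w hw)
      rwa [← mul_assoc, ← mul_assoc, (Algebra.adjoin R t).isIdempotentElem_toSubmodule.eq] at this
    · rw [add_mul]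
      exact add_mem ha hb

theorem span_mul_prod_adjoin_le {s : ι → Set A} {l : List ι}
    (h : l.Pairwise fun a b => span R (s b) * span R (s a) ≤ span R (s a) * span R (s b))
    {i : ι} (hi : i ∈ l) :
    span R (s i) * (l.map fun a => (Algebra.adjoin R (s a)).toSubmodule).prod
      ≤ (l.map fun a => (Algebra.adjoin R (s a)).toSubmodule).prod := by
  induction l with
  | nil => simp at hi
  | cons a l ih =>
    rw [List.pairwise_cons] at h
    rw [List.map_cons, List.prod_cons, ← mul_assoc]
    rcases List.mem_cons.1 hi with rfl | hi
    · have absorb : span R (s i) * (Algebra.adjoin R (s i)).toSubmodule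
          ≤ (Algebra.adjoin R (s i)).toSubmodule :=
        (mul_le_mul_left (span_le.2 Algebra.subset_adjoin) _).trans_eq
          (Algebra.adjoin R (s i)).isIdempotentElem_toSubmodule
      exact mul_le_mul_left absorb _
    · refine (mul_le_mul_left (span_mul_adjoin_le (h.1 i hi)) _).trans ?_
      rw [mul_assoc]
      exact mul_le_mul_right (ih h.2 hi) _

theorem adjoin_iUnion_le_prod_adjoin {s : ι → Set A} {l : List ι} (hl : ∀ i, i ∈ l)
    (h : l.Pairwise fun a b => span R (s b) * span R (s a) ≤ span R (s a) * span R (s b)) :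
    (Algebra.adjoin R (⋃ i, s i)).toSubmodule
      ≤ (l.map fun a => (Algebra.adjoin R (s a)).toSubmodule).prod := by
  set P := (l.map fun a => (Algebra.adjoin R (s a)).toSubmodule).prod
  have one_mem : (1 : A) ∈ P := by
    refine one_le.1 (List.one_le_prod_of_one_le fun S hS => ?_)
    obtain ⟨i, -, rfl⟩ := List.mem_map.1 hS
    exact one_le.2 (one_mem (Algebra.adjoin R (s i)))
  have mul_mem : ∀ x ∈ Algebra.adjoin R (⋃ i, s i), ∀ y ∈ P, x * y ∈ P := by
    intro x hx
    induction hx using Algebra.adjoin_induction with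
    | mem x hx =>
      obtain ⟨i, hi⟩ := Set.mem_iUnion.1 hx
      exact fun y hy => span_mul_prod_adjoin_le h (hl i) (mul_mem_mul (subset_span hi) hy)
    | algebraMap r => exact fun y hy => by rw [← Algebra.smul_def]; exact P.smul_mem r hy
    | add x y _ _ hx hy => exact fun z hz => by rw [add_mul]; exact add_mem (hx z hz) (hy z hz)
    | mul x y _ _ hx hy => exact fun z hz => by rw [mul_assoc]; exact hx _ (hy z hz)
  exact fun x hx => by simpa using mul_mem x hx 1 one_mem

theorem prod_span_range_le [Nonempty κ] (f : ι → κ → A) {l : List ι} (hl : l.Nodup) :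
    (l.map fun i => span R (Set.range (f i))).prod
      ≤ span R (Set.range fun c : ι → κ => (l.map fun i => f i (c i)).prod) := by
  classical
  induction l with
  | nil => simp [one_eq_span]
  | cons a l ih =>
    rw [List.nodup_cons] at hl
    rw [List.map_cons, List.prod_cons]
    refine (mul_le_mul_right (ih hl.2) _).trans ?_
    rw [span_mul_span]
    refine span_mono (Set.mul_subset_iff.2 ?_)
    rintro _ ⟨k, rfl⟩ _ ⟨c, rfl⟩
    refine ⟨Function.update c a k, ?_⟩
    simp only [List.map_cons, List.prod_cons, Function.update_self]
    congr 2
    refine List.map_congr_left fun i hi => ?_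
    rw [Function.update_of_ne (ne_of_mem_of_not_mem hi hl.1)]

theorem toSubmodule_adjoin_singleton (x : A) :
    (Algebra.adjoin R {x}).toSubmodule = span R (Set.range (x ^ · : ℕ → A)) := by
  rw [Algebra.adjoin_eq_span, Submonoid.closure_singleton_eq]
  rfl

end OrderedProducts

/-! ### Normally ordered monomials -/

section Monomial

variable {R S : Type*} [Ring R] [Ring S] {n : ℕ}

/-- The normally ordered monomial `x_A` in the entries of an arbitrary array `x`; for the array of
generators of `𝒪_q(n)` this is `normalMonomial A`. -/
def monomial (x : Fin n → Fin n → R) (A : Matrix (Fin n) (Fin n) ℕ) : R :=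
  ((List.finRange n).map fun j =>
    ((List.finRange n).reverse.map fun i => x i j ^ A i j).prod).prod

theorem monomial_eq_zero {x : Fin n → Fin n → R} {A : Matrix (Fin n) (Fin n) ℕ} {i j : Fin n}
    (hx : x i j = 0) (hA : A i j ≠ 0) : monomial x A = 0 := by
  refine List.prod_eq_zero (List.mem_map.2 ⟨j, List.mem_finRange j, ?_⟩)
  refine List.prod_eq_zero (List.mem_map.2 ⟨i, List.mem_reverse.2 (List.mem_finRange i), ?_⟩)
  rw [hx, zero_pow hA]

variable [Algebra Zq R] [Algebra Zq S]

theorem map_monomial (φ : R →ₐ[Zq] S) (x : Fin n → Fin n → R) (A : Matrix (Fin n) (Fin n) ℕ) :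
    φ (monomial x A) = monomial (fun i j => φ (x i j)) A := by
  simp [monomial, map_list_prod, Function.comp_def]

theorem IsManin.map {x : Fin n → Fin n → R} (hx : IsManin x) (φ : R →ₐ[Zq] S) :
    IsManin fun i j => φ (x i j) where
  comm i k j l hik hlj := by simp only [← map_mul, hx.comm i k j l hik hlj]
  cross i k j l hki hlj := by
    simp only [← map_mul, ← map_smul, ← map_sub, hx.cross i k j l hki hlj]
  row i j l hlj := by simp only [← map_mul, ← map_smul, hx.row i j l hlj]
  col i k j hik := by simp only [← map_mul, ← map_smul, hx.col i k j hik]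

theorem IsManin.span_col_mul_span_col_le {x : Fin n → Fin n → R} (hx : IsManin x) {j l : Fin n}
    (h : l < j) :
    Submodule.span Zq (Set.range fun i => x i j) * Submodule.span Zq (Set.range fun i => x i l)
      ≤ Submodule.span Zq (Set.range fun i => x i l)
        * Submodule.span Zq (Set.range fun i => x i j) := by
  have mem : ∀ i k, x i l * x k j ∈ Submodule.span Zq (Set.range fun i => x i l)
        * Submodule.span Zq (Set.range fun i => x i j) := fun i k =>
    Submodule.mul_mem_mul (Submodule.subset_span ⟨i, rfl⟩) (Submodule.subset_span ⟨k, rfl⟩)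
  rw [Submodule.span_mul_span, Submodule.span_le, Set.mul_subset_iff]
  rintro _ ⟨i, rfl⟩ _ ⟨k, rfl⟩
  rcases lt_trichotomy i k with hik | rfl | hik
  · exact hx.comm i k j l hik h ▸ mem k i
  · exact hx.row i j l h ▸ Submodule.smul_mem _ _ (mem i i)
  · exact hx.cross i k j l hik h ▸ sub_mem (mem k i) (Submodule.smul_mem _ _ (mem i k))

theorem IsManin.adjoin_col_le {x : Fin n → Fin n → R} (hx : IsManin x) (j : Fin n) :
    (Algebra.adjoin Zq (Set.range fun i => x i j)).toSubmodule
      ≤ Submodule.span Zq (Set.range fun c : Fin n → ℕ =>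
          ((List.finRange n).reverse.map fun i => x i j ^ c i).prod) := by
  rw [show (Set.range fun i => x i j) = ⋃ i, {x i j} from (Set.iUnion_singleton_eq_range _).symm]
  refine (adjoin_iUnion_le_prod_adjoin (l := (List.finRange n).reverse) (by simp) ?_).trans ?_
  · refine List.pairwise_reverse.2 ((List.pairwise_lt_finRange n).imp fun {i k} hik => ?_)
    rw [Submodule.span_mul_span, Submodule.span_mul_span, Set.singleton_mul_singleton,
      Set.singleton_mul_singleton, Submodule.span_singleton_le_iff_mem, hx.col i k j hik]
    exact Submodule.smul_mem _ _ (Submodule.mem_span_singleton_self _)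
  · simp only [toSubmodule_adjoin_singleton]
    exact prod_span_range_le (fun i k => x i j ^ k) (List.nodup_reverse.2 (List.nodup_finRange n))

theorem IsManin.adjoin_le_span_monomial {x : Fin n → Fin n → R} (hx : IsManin x) :
    (Algebra.adjoin Zq (⋃ j, Set.range fun i => x i j)).toSubmodule
      ≤ Submodule.span Zq (Set.range (monomial x)) := by
  refine (adjoin_iUnion_le_prod_adjoin List.mem_finRange
    ((List.pairwise_lt_finRange n).imp fun h => hx.span_col_mul_span_col_le h)).trans ?_
  refine (List.prod_le_prod' fun j _ => hx.adjoin_col_le j).trans ?_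
  refine (prod_span_range_le _ (List.nodup_finRange n)).trans (Submodule.span_mono ?_)
  rintro _ ⟨c, rfl⟩
  exact ⟨fun i j => c j i, rfl⟩

theorem Oq.adjoin_gen (n : ℕ) :
    Algebra.adjoin Zq (⋃ j, Set.range fun i => (gen i j : Oq n)) = ⊤ := by
  have surj : Function.Surjective (Oq.mk n) := RingQuot.mkAlgHom_surjective Zq _
  rw [← top_le_iff, ← (AlgHom.range_eq_top _).2 surj, ← Algebra.map_top,
    ← FreeAlgebra.adjoin_range_ι, AlgHom.map_adjoin]
  refine Algebra.adjoin_mono ?_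
  rintro _ ⟨_, ⟨p, rfl⟩, rfl⟩
  exact Set.mem_iUnion.2 ⟨p.2, p.1, rfl⟩

theorem span_normalMonomial (n : ℕ) :
    Submodule.span Zq (Set.range (normalMonomial (n := n))) = ⊤ :=
  top_le_iff.1 ((isManin_gen n).adjoin_le_span_monomial.trans' (by rw [Oq.adjoin_gen]; rfl))

theorem dualMonomial_eq {A : Matrix (Fin n) (Fin n) ℕ} {f : Oq n →ₗ[Zq] Zq}
    (hf : ∀ B, f (normalMonomial B) = if B = A then 1 else 0) : dualMonomial A = f := by
  have h : ∃ f : Oq n →ₗ[Zq] Zq, ∀ B, f (normalMonomial B) = if B = A then 1 else 0 := ⟨f, hf⟩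
  refine LinearMap.ext_on_range (span_normalMonomial n) fun B => ?_
  rw [hf, dualMonomial, dif_pos h]
  convert h.choose_spec B

end Monomial

/-! ### Realizations of dual basis elements -/

section Pair

variable {K R S : Type*} [CommSemiring K] [Ring R] [Ring S] [Algebra K R] [Algebra K S]

/-- The functional `a ⊗ b ↦ f a * g b`. -/
def pair (f : R →ₗ[K] K) (g : S →ₗ[K] K) : R ⊗[K] S →ₗ[K] K :=
  LinearMap.mul' K K ∘ₗ TensorProduct.map f g

@[simp]
theorem pair_tmul (f : R →ₗ[K] K) (g : S →ₗ[K] K) (a : R) (b : S) :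
    pair f g (a ⊗ₜ b) = f a * g b := by
  simp [pair]

end Pair

section Realizes

variable {R S : Type*} [Ring R] [Ring S] [Algebra Zq R] [Algebra Zq S] {n : ℕ}

/-- The linear functional `f` on an algebra `R` and the array `x` in `R` *realize* the functional
dual to the normally ordered monomial `x_A`: it is the composite of `f` with the homomorphism
`𝒪_q(n) → R` sending the generators to the entries of `x`. -/
structure Realizes (x : Fin n → Fin n → R) (f : R →ₗ[Zq] Zq) (A : Matrix (Fin n) (Fin n) ℕ) :
    Prop where
  isManin : IsManin x
  apply_monomial : ∀ B, f (monomial x B) = if B = A then 1 else 0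

theorem Realizes.dualMonomial_eq {x : Fin n → Fin n → R} {f : R →ₗ[Zq] Zq}
    {A : Matrix (Fin n) (Fin n) ℕ} (h : Realizes x f A) :
    dualMonomial A = f ∘ₗ (Oq.lift x h.isManin).toLinearMap := by
  refine QSchur.dualMonomial_eq fun B => ?_
  have lift_normalMonomial : Oq.lift x h.isManin (normalMonomial B) = monomial x B :=
    (map_monomial _ _ _).trans (by simp only [Oq.lift_gen])
  simp [lift_normalMonomial, h.apply_monomial]

/-- The product of two arrays, viewed as matrices, with entries multiplied in `R ⊗ S`. -/
def tensorMul (x : Fin n → Fin n → R) (y : Fin n → Fin n → S) : Fin n → Fin n → R ⊗[Zq] S :=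
  fun i k => ∑ j, x i j ⊗ₜ y j k

theorem map_lift_comul_gen {x : Fin n → Fin n → R} {y : Fin n → Fin n → S} (hx : IsManin x)
    (hy : IsManin y) (i k : Fin n) :
    Algebra.TensorProduct.map (Oq.lift x hx) (Oq.lift y hy) (comul n (gen i k))
      = tensorMul x y i k := by
  simp [comul, Oq.lift_gen, tensorMul]

theorem IsManin.tensorMul {x : Fin n → Fin n → R} {y : Fin n → Fin n → S} (hx : IsManin x)
    (hy : IsManin y) : IsManin (tensorMul x y) := by
  have h := ((isManin_gen n).map (QSchur.comul n)).map
    (Algebra.TensorProduct.map (Oq.lift x hx) (Oq.lift y hy))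
  simpa only [map_lift_comul_gen] using h

theorem structConst_eq {x : Fin n → Fin n → R} {y : Fin n → Fin n → S} {f : R →ₗ[Zq] Zq}
    {g : S →ₗ[Zq] Zq} {A B : Matrix (Fin n) (Fin n) ℕ} (hx : Realizes x f A)
    (hy : Realizes y g B) (C : Matrix (Fin n) (Fin n) ℕ) :
    structConst A B C = pair f g (monomial (tensorMul x y) C) := by
  have map_comul : Algebra.TensorProduct.map (Oq.lift x hx.isManin) (Oq.lift y hy.isManin)
      (comul n (normalMonomial C)) = monomial (tensorMul x y) C := by
    rw [show normalMonomial C = monomial gen C from rfl, map_monomial, map_monomial]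
    simp only [map_lift_comul_gen]
  rw [structConst, hx.dualMonomial_eq, hy.dualMonomial_eq, TensorProduct.map_comp, ← map_comul]
  rfl

end Realizes

/-! ### Composition of standard basis vectors -/

theorem comp_xi {lam mu nu : List ℕ} (A : Mat lam mu) (B : Mat mu nu) :
    comp (xi A) (xi B) = ∑ C : Mat lam nu, Z A B C • xi C := by
  simp [comp, xi]

theorem Mat.pad_injective {lam mu : List ℕ} {n : ℕ} (hl : lam.length ≤ n) (hm : mu.length ≤ n) :
    Function.Injective fun A : Mat lam mu => A.pad n := by
  intro A B h
  refine Subtype.ext (Matrix.ext fun i j => ?_)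
  simpa [Mat.pad] using congrFun (congrFun h (i.castLE hl)) (j.castLE hm)

theorem comp_xi_eq_xi {R S : Type*} [Ring R] [Ring S] [Algebra Zq R] [Algebra Zq S]
    {lam mu nu : List ℕ} {n : ℕ} (hn : max lam.length (max mu.length nu.length) = n)
    {A : Mat lam mu} {B : Mat mu nu} {C : Mat lam nu}
    {x : Fin n → Fin n → R} {y : Fin n → Fin n → S} {f : R →ₗ[Zq] Zq} {g : S →ₗ[Zq] Zq}
    (hA : Realizes x f (A.pad n)) (hB : Realizes y g (B.pad n))
    (hC : Realizes (tensorMul x y) (pair f g) (C.pad n)) :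
    comp (xi A) (xi B) = xi C := by
  subst hn
  have pad_inj := Mat.pad_injective (lam := lam) (mu := nu) (n := max lam.length _)
    (le_max_left _ (max mu.length nu.length)) ((le_max_right _ _).trans (le_max_right _ _))
  have Z_eq : ∀ D, Z A B D = if D.pad _ = C.pad _ then 1 else 0 := fun D =>
    (structConst_eq hA hB _).trans (hC.apply_monomial _)
  rw [comp_xi, Finset.sum_eq_single C, Z_eq, if_pos rfl, one_smul]
  · intro D _ hD
    rw [Z_eq, if_neg (pad_inj.ne hD), zero_smul]
  · exact fun h => absurd (Finset.mem_univ _) h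

/-! ### Constructions of arrays satisfying Manin's relations -/

section Constructions

variable {R S : Type*} [Ring R] [Ring S] [Algebra Zq R] [Algebra Zq S] {m n : ℕ}

theorem isManin_diagonal {t : Fin n → R} (ht : ∀ i j, Commute (t i) (t j)) :
    IsManin (Matrix.diagonal t) := by
  constructor
  · intro i k j l hik hlj
    rcases ne_or_eq i j with h | rfl
    · simp [Matrix.diagonal_apply_ne _ h]
    · simp [Matrix.diagonal_apply_ne _ (hlj.trans hik).ne']
  · intro i k j l hki hlj
    rcases ne_or_eq i l with h | rfl
    · simp only [Matrix.diagonal_apply_ne _ h, zero_mul, smul_zero, sub_zero, Matrix.diagonal_apply]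
      split_ifs <;> simp [(ht _ _).eq]
    · simp [Matrix.diagonal_apply_ne _ hlj.ne, Matrix.diagonal_apply_ne _ hki.ne,
        Matrix.diagonal_apply_ne _ (hki.trans hlj).ne]
  · intro i j l hlj
    rcases ne_or_eq i j with h | rfl
    · simp [Matrix.diagonal_apply_ne _ h]
    · simp [Matrix.diagonal_apply_ne _ hlj.ne']
  · intro i k j hik
    rcases ne_or_eq i j with h | rfl
    · simp [Matrix.diagonal_apply_ne _ h]
    · simp [Matrix.diagonal_apply_ne _ hik.ne']

theorem IsManin.transpose {x : Fin n → Fin n → R} (hx : IsManin x) :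
    IsManin fun i j => x j i where
  comm i k j l hik hlj := (hx.comm l j k i hlj hik).symm
  cross i k j l hki hlj := by rw [hx.cross j l i k hlj hki, hx.comm l j i k hlj hki]
  row i j l hlj := by
    rw [hx.col l j i hlj, smul_smul, ← LaurentPolynomial.T_add, neg_add_cancel,
      LaurentPolynomial.T_zero, one_smul]
  col i k j hik := by
    rw [hx.row j k i hik, smul_smul, ← LaurentPolynomial.T_add, add_neg_cancel,
      LaurentPolynomial.T_zero, one_smul]

theorem isManin_graph {β : Fin n → Fin n} (hβ : Monotone β) {y : Fin n → R}
    (hcomm : ∀ i k, β i ≠ β k → Commute (y i) (y k))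
    (hcol : ∀ i k, i < k → β i = β k → y i * y k = qpow 1 • (y k * y i)) :
    IsManin fun i j => if j = β i then y i else 0 where
  comm i k j l hik hlj := by
    rcases ne_or_eq j (β i) with hj | rfl
    · simp [hj]
    · simp [(hlj.trans_le (hβ hik.le)).ne]
  cross i k j l hki hlj := by
    have hl : ¬(l = β i ∧ j = β k) := fun h => (hβ hki.le).not_gt (h.1 ▸ h.2 ▸ hlj)
    rcases ne_or_eq j (β i) with hj | rfl
    · rcases ne_or_eq l (β i) with hl' | rfl
      · simp [hj, hl']
      · simp [hj, not_and.1 hl rfl]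
    · rcases ne_or_eq l (β k) with hl' | rfl
      · simp [hl', hlj.ne]
      · simp [hlj.ne, (hcomm i k hlj.ne').eq]
  row i j l hlj := by
    rcases ne_or_eq j (β i) with hj | rfl
    · simp [hj]
    · simp [hlj.ne]
  col i k j hik := by
    rcases ne_or_eq j (β i) with hj | rfl
    · simp [hj]
    · rcases ne_or_eq (β i) (β k) with h | h
      · simp [h]
      · simp [h, hcol i k hik h]

/-- The block diagonal array with diagonal blocks `x` and `y`. -/
def blockDiag (x : Fin m → Fin m → R) (y : Fin n → Fin n → R) : Fin (m + n) → Fin (m + n) → R :=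
  Fin.addCases (fun i => Fin.addCases (x i) 0) (fun i => Fin.addCases 0 (y i))

theorem IsManin.blockDiag {x : Fin m → Fin m → R} {y : Fin n → Fin n → R} (hx : IsManin x)
    (hy : IsManin y) (h : ∀ i j k l, Commute (x i j) (y k l)) : IsManin (blockDiag x y) := by
  have castAdd_lt : ∀ i j : Fin m, Fin.castAdd n i < Fin.castAdd n j ↔ i < j := fun _ _ =>
    Iff.rfl
  have natAdd_not_lt : ∀ (i : Fin n) (j : Fin m), ¬Fin.natAdd m i < Fin.castAdd n j := fun i j =>
    (j.2.trans_le (Nat.le_add_right m i)).not_gt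
  constructor
  · intro i k j l hik hlj
    cases i using Fin.addCases <;> cases k using Fin.addCases <;> cases j using Fin.addCases <;>
      cases l using Fin.addCases <;>
      simp only [QSchur.blockDiag, castAdd_lt, natAdd_not_lt, Fin.natAdd_lt_natAdd_iff,
        Fin.addCases_left, Fin.addCases_right, Pi.zero_apply, zero_mul, mul_zero] at hik hlj ⊢
    exacts [hx.comm _ _ _ _ hik hlj, hy.comm _ _ _ _ hik hlj]
  · intro i k j l hki hlj
    cases i using Fin.addCases <;> cases k using Fin.addCases <;> cases j using Fin.addCases <;>
      cases l using Fin.addCases <;>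
      simp only [QSchur.blockDiag, castAdd_lt, natAdd_not_lt, Fin.natAdd_lt_natAdd_iff,
        Fin.addCases_left, Fin.addCases_right, Pi.zero_apply, zero_mul, mul_zero, smul_zero,
        sub_zero, sub_self, (h _ _ _ _).eq] at hki hlj ⊢
    exacts [hx.cross _ _ _ _ hki hlj, hy.cross _ _ _ _ hki hlj]
  · intro i j l hlj
    cases i using Fin.addCases <;> cases j using Fin.addCases <;>
      cases l using Fin.addCases <;>
      simp only [QSchur.blockDiag, castAdd_lt, natAdd_not_lt, Fin.natAdd_lt_natAdd_iff,
        Fin.addCases_left, Fin.addCases_right, Pi.zero_apply, zero_mul, mul_zero,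
        smul_zero] at hlj ⊢
    exacts [hx.row _ _ _ hlj, hy.row _ _ _ hlj]
  · intro i k j hik
    cases i using Fin.addCases <;> cases k using Fin.addCases <;> cases j using Fin.addCases <;>
      simp only [QSchur.blockDiag, castAdd_lt, natAdd_not_lt, Fin.natAdd_lt_natAdd_iff,
        Fin.addCases_left, Fin.addCases_right, Pi.zero_apply, zero_mul, mul_zero,
        smul_zero] at hik ⊢
    exacts [hx.col _ _ _ hik, hy.col _ _ _ hik]

end Constructions

section Graded

variable {R : Type*} [Ring R] [Algebra Zq R] {n : ℕ}

theorem Realizes.of_support {x : Fin n → Fin n → R} {f : R →ₗ[Zq] Zq}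
    {A : Matrix (Fin n) (Fin n) ℕ} (hx : IsManin x)
    (hf : ∀ B : Matrix (Fin n) (Fin n) ℕ, (∀ i j, x i j = 0 → A i j = 0 → B i j = 0) →
      f (monomial x B) = if B = A then 1 else 0) : Realizes x f A := by
  refine ⟨hx, fun B => ?_⟩
  by_cases hB : ∀ i j, x i j = 0 → A i j = 0 → B i j = 0
  · exact hf B hB
  · push Not at hB
    obtain ⟨i, j, hxij, hAij, hBij⟩ := hB
    have hBA : B ≠ A := fun h => hBij (h ▸ hAij)
    rw [monomial_eq_zero hxij hBij, map_zero, if_neg hBA]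

/-- The array obtained from `x` by attaching to the entries of the `j`-th column a central
variable `X j`, which records the column sums of the exponents of a monomial. -/
def graded (x : Fin n → Fin n → R) : Fin n → Fin n → R ⊗[Zq] MvPolynomial (Fin n) Zq :=
  fun i j => x i j ⊗ₜ MvPolynomial.X j

theorem IsManin.graded {x : Fin n → Fin n → R} (hx : IsManin x) : IsManin (graded x) := by
  have graded_eq : QSchur.graded x
      = QSchur.tensorMul x (Matrix.diagonal (MvPolynomial.X (R := Zq))) := by
    ext i k
    simp [QSchur.graded, QSchur.tensorMul, Matrix.diagonal_apply, TensorProduct.tmul_ite]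
  rw [graded_eq]
  exact hx.tensorMul (isManin_diagonal fun _ _ => Commute.all _ _)

theorem prod_map_tmul {ι K S T : Type*} [CommSemiring K] [Semiring S] [Algebra K S] [Semiring T]
    [Algebra K T] (l : List ι) (u : ι → S) (v : ι → T) :
    (l.map fun i => u i ⊗ₜ[K] v i).prod = (l.map u).prod ⊗ₜ (l.map v).prod := by
  induction l with
  | nil => rfl
  | cons i l ih => simp [ih]

/-- The column sums of a matrix, as an exponent vector. -/
def colSum (A : Matrix (Fin n) (Fin n) ℕ) : Fin n →₀ ℕ :=
  Finsupp.equivFunOnFinite.symm fun j => ∑ i, A i j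

theorem monomial_colSum (A : Matrix (Fin n) (Fin n) ℕ) :
    MvPolynomial.monomial (colSum A) (1 : Zq) = ∏ j, MvPolynomial.X j ^ ∑ i, A i j := by
  rw [MvPolynomial.monomial_eq, map_one, one_mul, Finsupp.prod_fintype _ _ fun _ => pow_zero _]
  rfl

theorem lcoeff_colSum (A : Matrix (Fin n) (Fin n) ℕ) :
    MvPolynomial.lcoeff Zq (colSum A) (∏ j, MvPolynomial.X j ^ ∑ i, A i j) = 1 := by
  rw [← monomial_colSum, MvPolynomial.lcoeff_apply, MvPolynomial.coeff_monomial, if_pos rfl]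

theorem monomial_graded (x : Fin n → Fin n → R) (A : Matrix (Fin n) (Fin n) ℕ) :
    monomial (graded x) A = monomial x A ⊗ₜ MvPolynomial.monomial (colSum A) 1 := by
  have prod_col : ∀ j, ((List.finRange n).reverse.map fun i => graded x i j ^ A i j).prod
      = ((List.finRange n).reverse.map fun i => x i j ^ A i j).prod
        ⊗ₜ (MvPolynomial.X j ^ ∑ i, A i j) := by
    intro j
    simp only [graded, Algebra.TensorProduct.tmul_pow]
    rw [prod_map_tmul, ← Finset.prod_pow_eq_pow_sum, Fin.prod_univ_def,
      ((List.reverse_perm _).map _).prod_eq]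
  simp only [monomial, prod_col]
  rw [prod_map_tmul, ← Fin.prod_univ_def, monomial_colSum]

theorem realizes_graded {x : Fin n → Fin n → R} {f : R →ₗ[Zq] Zq}
    {A : Matrix (Fin n) (Fin n) ℕ} (hx : IsManin x)
    (hf : ∀ B : Matrix (Fin n) (Fin n) ℕ, (∀ i j, x i j = 0 → A i j = 0 → B i j = 0) →
      (∀ j, ∑ i, B i j = ∑ i, A i j) → f (monomial x B) = if B = A then 1 else 0) :
    Realizes (graded x) (pair f (MvPolynomial.lcoeff Zq (colSum A))) A := by
  refine .of_support hx.graded fun B hB => ?_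
  rw [monomial_graded, pair_tmul, MvPolynomial.lcoeff_apply, MvPolynomial.coeff_monomial]
  by_cases hBA : colSum B = colSum A
  · rw [if_pos hBA, mul_one]
    refine hf B (fun i j hx => hB i j ?_) (DFunLike.congr_fun hBA)
    rw [graded, hx, TensorProduct.zero_tmul]
  · rw [if_neg hBA, mul_zero, if_neg fun h => hBA (congrArg colSum h)]

end Graded

section Monomial

variable {R : Type*} [Ring R]

theorem monomial_two (x : Fin 2 → Fin 2 → R) (A : Matrix (Fin 2) (Fin 2) ℕ) :
    monomial x A = x 1 0 ^ A 1 0 * x 0 0 ^ A 0 0 * (x 1 1 ^ A 1 1 * x 0 1 ^ A 0 1) := by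
  simp [monomial, List.finRange_succ]

theorem monomial_four (x : Fin 4 → Fin 4 → R) (A : Matrix (Fin 4) (Fin 4) ℕ) :
    monomial x A
      = x 3 0 ^ A 3 0 * x 2 0 ^ A 2 0 * x 1 0 ^ A 1 0 * x 0 0 ^ A 0 0
        * (x 3 1 ^ A 3 1 * x 2 1 ^ A 2 1 * x 1 1 ^ A 1 1 * x 0 1 ^ A 0 1)
        * (x 3 2 ^ A 3 2 * x 2 2 ^ A 2 2 * x 1 2 ^ A 1 2 * x 0 2 ^ A 0 2)
        * (x 3 3 ^ A 3 3 * x 2 3 ^ A 2 3 * x 1 3 ^ A 1 3 * x 0 3 ^ A 0 3) := by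
  simp [monomial, List.finRange_succ, mul_assoc]

end Monomial

/-! ### Vanishing of functionals on one-sided ideals -/

section Ideals

variable {R M F : Type*} [Ring R] [AddZeroClass M] [FunLike F R M] [AddMonoidHomClass F R M]
  {f : F} {u x y : R}

theorem map_mul_add_pow_mul (h : ∀ m w, f (u * x ^ m * y * w) = 0) (n : ℕ) (w : R) :
    f (u * (x + y) ^ n * w) = f (u * x ^ n * w) := by
  induction n generalizing w with
  | zero => simp
  | succ n ih =>
    calc f (u * (x + y) ^ (n + 1) * w) = f (u * (x + y) ^ n * ((x + y) * w)) := by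
          simp only [pow_succ, mul_assoc]
      _ = f (u * x ^ (n + 1) * w) + f (u * x ^ n * y * w) := by
          rw [ih, ← map_add, pow_succ]
          congr 1
          noncomm_ring
      _ = f (u * x ^ (n + 1) * w) := by rw [h, add_zero]

theorem map_mul_add_pow_mul' (h : ∀ m w, f (w * (y * x ^ m * u)) = 0) (n : ℕ) (w : R) :
    f (w * ((x + y) ^ n * u)) = f (w * (x ^ n * u)) := by
  induction n generalizing w with
  | zero => simp
  | succ n ih =>
    calc f (w * ((x + y) ^ (n + 1) * u)) = f (w * (x + y) * ((x + y) ^ n * u)) := by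
          simp only [pow_succ', mul_assoc]
      _ = f (w * (x ^ (n + 1) * u)) + f (w * (y * x ^ n * u)) := by
          rw [ih, ← map_add, pow_succ']
          congr 1
          noncomm_ring
      _ = f (w * (x ^ (n + 1) * u)) := by rw [h, add_zero]

end Ideals

section Pair

variable {K R S : Type*} [CommSemiring K] [Ring R] [Ring S] [Algebra K R] [Algebra K S]

theorem pair_tmul_mul_eq_zero_of_left {f : R →ₗ[K] K} {a : R} (h : ∀ r, f (a * r) = 0)
    (g : S →ₗ[K] K) (b : S) (w : R ⊗[K] S) : pair f g ((a ⊗ₜ b) * w) = 0 := by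
  induction w with
  | zero => simp
  | tmul r s => simp [h]
  | add v w hv hw => rw [mul_add, map_add, hv, hw, add_zero]

theorem pair_tmul_mul_eq_zero_of_right {g : S →ₗ[K] K} {b : S} (h : ∀ s, g (b * s) = 0)
    (f : R →ₗ[K] K) (a : R) (w : R ⊗[K] S) : pair f g ((a ⊗ₜ b) * w) = 0 := by
  induction w with
  | zero => simp
  | tmul r s => simp [h]
  | add v w hv hw => rw [mul_add, map_add, hv, hw, add_zero]

theorem pair_mul_tmul_eq_zero_of_left {f : R →ₗ[K] K} {a : R} (h : ∀ r, f (r * a) = 0)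
    (g : S →ₗ[K] K) (b : S) (w : R ⊗[K] S) : pair f g (w * (a ⊗ₜ b)) = 0 := by
  induction w with
  | zero => simp
  | tmul r s => simp [h]
  | add v w hv hw => rw [add_mul, map_add, hv, hw, add_zero]

theorem pair_mul_tmul_eq_zero_of_right {g : S →ₗ[K] K} {b : S} (h : ∀ s, g (s * b) = 0)
    (f : R →ₗ[K] K) (a : R) (w : R ⊗[K] S) : pair f g (w * (a ⊗ₜ b)) = 0 := by
  induction w with
  | zero => simp
  | tmul r s => simp [h]
  | add v w hv hw => rw [add_mul, map_add, hv, hw, add_zero]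

end Pair

theorem qpow_add (j k : ℤ) : qpow (j + k) = qpow j * qpow k :=
  LaurentPolynomial.T_add j k

/-! ### Weighted shift operators -/

section WeightedShift

variable {K ι : Type*} [CommSemiring K]

/-- The operator `e_σ ↦ c σ • e_{t σ}` on the free module with basis `e`. -/
def weightedShift (c : ι → K) (t : ι → ι) : Module.End K (ι →₀ K) :=
  Finsupp.linearCombination K fun σ => c σ • Finsupp.single (t σ) 1

theorem weightedShift_single_one (c : ι → K) (t : ι → ι) (σ : ι) :
    weightedShift c t (Finsupp.single σ 1) = c σ • Finsupp.single (t σ) 1 := by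
  rw [weightedShift, Finsupp.linearCombination_single, one_smul]

theorem end_ext {T U : Module.End K (ι →₀ K)}
    (h : ∀ σ, T (Finsupp.single σ 1) = U (Finsupp.single σ 1)) : T = U :=
  Finsupp.lhom_ext' fun σ => LinearMap.ext_ring (h σ)

/-- The entry of an operator in row `τ` and column `σ`, as a linear functional. -/
def entry (τ σ : ι) : Module.End K (ι →₀ K) →ₗ[K] K :=
  Finsupp.lapply τ ∘ₗ LinearMap.applyₗ (Finsupp.single σ 1)

theorem entry_apply (τ σ : ι) (T : Module.End K (ι →₀ K)) :
    entry τ σ T = T (Finsupp.single σ 1) τ := rfl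

end WeightedShift

/-! ### The `q`-oscillator -/

section Oscillator

/-- The raising operator `e_m ↦ e_{m + 1}` of the `q`-oscillator. -/
def raise : Module.End Zq (ℕ →₀ Zq) := weightedShift 1 (· + 1)

/-- The lowering operator `e_m ↦ (q ^ (1 - 2 * m) - q) • e_{m - 1}` of the `q`-oscillator.
The weight vanishes at `m = 0`, where the subtraction truncates. -/
def lower : Module.End Zq (ℕ →₀ Zq) :=
  weightedShift (fun m => qpow (1 - 2 * m) - qpow 1) (· - 1)

/-- The operator `q ^ (-N)`, where `N` is the number operator `e_m ↦ m • e_m`. -/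
def number : Module.End Zq (ℕ →₀ Zq) := weightedShift (fun m => qpow (-m)) id

/-- The `2 × 2` array formed by the operators of the `q`-oscillator. -/
def oscillator : Fin 2 → Fin 2 → Module.End Zq (ℕ →₀ Zq) := !![raise, number; number, lower]

theorem raise_single (m : ℕ) : raise (Finsupp.single m 1) = Finsupp.single (m + 1) 1 := by
  simp [raise, weightedShift_single_one]

theorem number_single (m : ℕ) :
    number (Finsupp.single m 1) = qpow (-m) • Finsupp.single m 1 :=
  weightedShift_single_one _ _ _

theorem lower_single_zero : lower (Finsupp.single 0 1) = 0 := by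
  simp [lower, weightedShift_single_one]

theorem lower_single_succ (m : ℕ) :
    lower (Finsupp.single (m + 1) 1) = (qpow (-1 - 2 * m) - qpow 1) • Finsupp.single m 1 := by
  rw [lower, weightedShift_single_one]
  congr 3
  push_cast
  ring

theorem number_mul_raise : number * raise = qpow (-1) • (raise * number) := by
  refine end_ext fun m => ?_
  simp only [Module.End.mul_apply, LinearMap.smul_apply, raise_single, number_single, map_smul,
    smul_smul, ← qpow_add]
  congr 2
  push_cast
  ring

theorem lower_mul_number : lower * number = qpow (-1) • (number * lower) := by
  refine end_ext fun m => ?_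
  cases m with
  | zero => simp [number_single, lower_single_zero]
  | succ m =>
    have h : qpow (-(m + 1 : ℕ)) = qpow (-1) * qpow (-m) := by
      rw [← qpow_add]
      congr 1
      push_cast
      ring
    simp only [Module.End.mul_apply, LinearMap.smul_apply, lower_single_succ, number_single,
      map_smul, h]
    module

theorem lower_mul_raise : lower * raise = raise * lower - hq • (number * number) := by
  refine end_ext fun m => ?_
  cases m with
  | zero => simp [number_single, raise_single, lower_single_zero, lower_single_succ]
  | succ m =>
    simp only [Module.End.mul_apply, LinearMap.smul_apply, LinearMap.sub_apply, raise_single,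
      lower_single_succ, number_single, map_smul, smul_smul, ← sub_smul, sub_mul, hq,
      ← qpow_add]
    congr 1
    have h1 : (1 : ℤ) + (-((m + 1 : ℕ) : ℤ) + -((m + 1 : ℕ) : ℤ)) = -1 - 2 * m := by
      push_cast; ring
    have h2 : (-1 : ℤ) + (-((m + 1 : ℕ) : ℤ) + -((m + 1 : ℕ) : ℤ)) = -1 - 2 * (m + 1 : ℕ) := by
      push_cast; ring
    rw [h1, h2]
    ring

theorem isManin_oscillator : IsManin oscillator := by
  constructor
  · simp [Fin.forall_fin_two, oscillator]
  · simp [Fin.forall_fin_two, oscillator, lower_mul_raise]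
  · simp [Fin.forall_fin_two, oscillator, number_mul_raise, lower_mul_number]
  · simp [Fin.forall_fin_two, oscillator, number_mul_raise, lower_mul_number, smul_smul,
      -LaurentPolynomial.T_mul, ← LaurentPolynomial.T_add]

theorem raise_pow_single_zero (s : ℕ) :
    (raise ^ s) (Finsupp.single 0 1) = Finsupp.single s 1 := by
  induction s with
  | zero => rfl
  | succ s ih => rw [pow_succ', Module.End.mul_apply, ih, raise_single]

theorem number_pow_single (c m : ℕ) :
    (number ^ c) (Finsupp.single m 1) = qpow (-(c * m)) • Finsupp.single m 1 := by
  induction c with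
  | zero => simp
  | succ c ih =>
    rw [pow_succ, Module.End.mul_apply, number_single, map_smul, ih, smul_smul,
      ← qpow_add]
    congr 2
    push_cast
    ring

theorem lower_pow_single (s : ℕ) :
    (lower ^ s) (Finsupp.single s 1)
      = (qpow (-((s : ℤ) * (s - 1) / 2)) * (qpow (-1) - qpow 1) ^ s * qFactorial s)
        • Finsupp.single 0 1 := by
  induction s with
  | zero => simp [qFactorial]
  | succ s ih =>
    have weight_eq : qpow (-1 - 2 * s) - qpow 1
        = qpow (-s) * (qpow (-1) - qpow 1) * qInt (s + 1) := by
      have hqInt := hq_mul_qInt (s + 1)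
      have split_exponents : qpow (-1 - 2 * s) = qpow (-s) * qpow (-(s + 1 : ℕ))
          ∧ qpow 1 = qpow (-s) * qpow (s + 1 : ℕ) := by
        constructor <;> (rw [← qpow_add]; congr 1; push_cast; ring)
      rw [hq] at hqInt
      linear_combination split_exponents.1 - split_exponents.2 + qpow (-s) * hqInt
    have exponent_eq : -(((s + 1 : ℕ) : ℤ) * ((s + 1 : ℕ) - 1) / 2)
        = -s + -((s : ℤ) * (s - 1) / 2) := by
      rw [show ((s + 1 : ℕ) : ℤ) * ((s + 1 : ℕ) - 1) = s * (s - 1) + s * 2 by push_cast; ring,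
        Int.add_mul_ediv_right _ _ two_ne_zero]
      ring
    rw [pow_succ, Module.End.mul_apply, lower_single_succ, map_smul, ih, smul_smul, weight_eq,
      exponent_eq, qpow_add, qFactorial, qFactorial, Finset.prod_range_succ]
    congr 1
    ring

theorem entry_number_pow_mul_raise_mul (m : ℕ) (T : Module.End Zq (ℕ →₀ Zq)) :
    entry 0 0 (number ^ m * raise * T) = 0 := by
  have h : Finsupp.lapply 0 ∘ₗ (number ^ m * raise) = 0 := by
    refine Finsupp.lhom_ext' fun k => LinearMap.ext_ring ?_
    simp [raise_single, number_pow_single]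
  exact LinearMap.congr_fun h _

theorem entry_mul_lower_mul_number_pow (m : ℕ) (T : Module.End Zq (ℕ →₀ Zq)) :
    entry 0 0 (T * (lower * number ^ m)) = 0 := by
  simp [entry_apply, number_pow_single, lower_single_zero]

theorem entry_number_pow (m : ℕ) : entry 0 0 (number ^ m) = 1 := by
  simp [entry_apply, number_pow_single]

theorem entry_antinormal (s m : ℕ) :
    entry 0 0 (lower ^ s * number ^ m * raise ^ s)
      = qpow (-((s : ℤ) * (s - 1) / 2) - s * m) * (qpow (-1) - qpow 1) ^ s * qFactorial s := by
  rw [entry_apply, Module.End.mul_apply, Module.End.mul_apply, raise_pow_single_zero,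
    number_pow_single, map_smul, lower_pow_single, smul_smul, sub_eq_add_neg _ (s * m : ℤ),
    qpow_add, Finsupp.smul_apply, Finsupp.single_eq_same, smul_eq_mul, mul_one, mul_comm (s : ℤ) m]
  ring

end Oscillator

/-! ### Skew polynomial variables -/

section SkewVar

variable {n : ℕ} {w : Matrix (Fin n) (Fin n) ℤ}

/-- Multiplication by the `j`-th variable of a skew polynomial ring, on the basis of ordered
monomials `e_σ`: the operator `e_σ ↦ q ^ (∑ i, w j i * σ i) • e_{σ + δ_j}`. The exponent matrix `w`
governs the relations `y_i * y_k = q ^ (w i k - w k i) • (y_k * y_i)`. -/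
def skewVar (w : Matrix (Fin n) (Fin n) ℤ) (j : Fin n) : Module.End Zq ((Fin n → ℕ) →₀ Zq) :=
  weightedShift (fun σ => qpow (∑ i, w j i * σ i)) (· + Pi.single j 1)

theorem skewVar_single (j : Fin n) (σ : Fin n → ℕ) :
    skewVar w j (Finsupp.single σ 1)
      = qpow (∑ i, w j i * σ i) • Finsupp.single (σ + Pi.single j 1) 1 :=
  weightedShift_single_one _ _ _

theorem skewVar_mul_skewVar (w : Matrix (Fin n) (Fin n) ℤ) (i k : Fin n) :
    skewVar w i * skewVar w k = qpow (w i k - w k i) • (skewVar w k * skewVar w i) := by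
  refine end_ext fun σ => ?_
  simp only [Module.End.mul_apply, LinearMap.smul_apply, skewVar_single, map_smul, smul_smul,
    ← qpow_add, add_right_comm σ]
  congr 2
  simp only [Pi.add_apply, Pi.single_apply, Nat.cast_add, Nat.cast_ite, Nat.cast_one,
    CharP.cast_eq_zero, mul_add, mul_ite, mul_one, mul_zero, Finset.sum_add_distrib,
    Finset.sum_ite_eq', Finset.mem_univ, ↓reduceIte]
  ring

theorem commute_skewVar {i k : Fin n} (h : w i k = w k i) :
    Commute (skewVar w i) (skewVar w k) := by
  rw [commute_iff_eq, skewVar_mul_skewVar, h, sub_self, qpow, LaurentPolynomial.T_zero, one_smul]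

theorem skewVar_pow_single {j : Fin n} (hj : w j j = 0) (m : ℕ) (σ : Fin n → ℕ) :
    (skewVar w j ^ m) (Finsupp.single σ 1)
      = qpow (m * ∑ i, w j i * σ i) • Finsupp.single (σ + Pi.single j m) 1 := by
  induction m with
  | zero => simp
  | succ m ih =>
    rw [pow_succ', Module.End.mul_apply, ih, map_smul, skewVar_single, smul_smul, ← qpow_add,
      add_assoc, ← Pi.single_add]
    congr 2
    simp only [Pi.add_apply, Pi.single_apply, Nat.cast_add, Nat.cast_ite, CharP.cast_eq_zero,
      mul_add, mul_ite, mul_zero, Finset.sum_add_distrib, Finset.sum_ite_eq', Finset.mem_univ,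
      ↓reduceIte, hj, zero_mul, add_zero, Nat.cast_one]
    ring

/-- The map `{0, 1, 2, 3} → {0, 1}` recording which of two strings, each in two parts, a part
belongs to; its values lie in `Fin 4` because matrices are padded to a common square format. -/
def halves : Fin 4 → Fin 4 := ![0, 0, 1, 1]

theorem isManin_graph_skewVar {w : Matrix (Fin 4) (Fin 4) ℤ}
    (hcomm : ∀ i k, halves i = halves k ∨ w i k = w k i)
    (hcol : ∀ i k, i < k → halves i = halves k → w i k - w k i = 1) :
    IsManin fun i j => if j = halves i then skewVar w i else 0 :=
  isManin_graph (by decide) (fun i k h => commute_skewVar ((hcomm i k).resolve_left h))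
    fun i k hik h => by rw [skewVar_mul_skewVar, hcol i k hik h]

/-- The weights of the skew variables that realize a pair of splits. -/
def splitWeight : Matrix (Fin 4) (Fin 4) ℤ := !![0, 1, 0, 0; 0, 0, 0, 0; 0, 0, 0, 1; 0, 0, 0, 0]

/-- The weights of the skew variables that realize a pair of merges. They satisfy the same relations
as those for `splitWeight`, but the ordered monomials are taken in a different order. -/
def mergeWeight : Matrix (Fin 4) (Fin 4) ℤ := !![0, 0, 0, 0; -1, 0, 0, 0; 0, 0, 0, 0; 0, 0, -1, 0]

/-- The array of skew variables that realizes a pair of splits: it has the shape of a pair of column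
vectors on the block diagonal. -/
def splitArray : Fin 4 → Fin 4 → Module.End Zq ((Fin 4 → ℕ) →₀ Zq) :=
  fun i j => if j = halves i then skewVar splitWeight i else 0

/-- The array of skew variables that realizes a pair of merges: it has the shape of a pair of row
vectors on the block diagonal. -/
def mergeArray : Fin 4 → Fin 4 → Module.End Zq ((Fin 4 → ℕ) →₀ Zq) :=
  fun i j => if i = halves j then skewVar mergeWeight j else 0

theorem isManin_splitArray : IsManin splitArray :=
  isManin_graph_skewVar (by simp [Fin.forall_fin_succ, halves, splitWeight]) (by decide)

theorem isManin_mergeArray : IsManin mergeArray :=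
  (isManin_graph_skewVar (by simp [Fin.forall_fin_succ, halves, mergeWeight]) (by decide)).transpose

theorem single_add_single_four (a b c d : ℕ) :
    (Pi.single 0 a + Pi.single 1 b + Pi.single 2 c + Pi.single 3 d : Fin 4 → ℕ)
      = ![a, b, c, d] := by
  ext i
  fin_cases i <;> simp

theorem entry_splitWeight (τ : Fin 4 → ℕ) (a b c d : ℕ) :
    entry τ 0 (skewVar splitWeight 1 ^ b * skewVar splitWeight 0 ^ a
      * (skewVar splitWeight 3 ^ d * skewVar splitWeight 2 ^ c))
      = if ![a, b, c, d] = τ then 1 else 0 := by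
  have sum_eq : Pi.single 2 c + Pi.single 3 d + Pi.single 0 a + Pi.single 1 b
      = ![a, b, c, d] := by
    rw [← single_add_single_four]
    abel
  simp [entry_apply, skewVar_pow_single, Fin.sum_univ_four, splitWeight, sum_eq,
    Finsupp.single_apply]

theorem entry_mergeWeight (τ : Fin 4 → ℕ) (a b c d : ℕ) :
    entry τ 0 (skewVar mergeWeight 0 ^ a * skewVar mergeWeight 1 ^ b
      * skewVar mergeWeight 2 ^ c * skewVar mergeWeight 3 ^ d)
      = if ![a, b, c, d] = τ then 1 else 0 := by
  have sum_eq : Pi.single 3 d + Pi.single 2 c + Pi.single 1 b + Pi.single 0 a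
      = ![a, b, c, d] := by
    rw [← single_add_single_four]
    abel
  simp [entry_apply, skewVar_pow_single, Fin.sum_univ_four, mergeWeight, sum_eq,
    Finsupp.single_apply]

theorem entry_mergeWeight_interleaved (τ : Fin 4 → ℕ) (a b c d : ℕ) :
    entry τ 0 (skewVar mergeWeight 2 ^ c * skewVar mergeWeight 0 ^ a
      * (skewVar mergeWeight 3 ^ d * skewVar mergeWeight 1 ^ b))
      = if ![a, b, c, d] = τ then 1 else 0 := by
  have sum_eq : Pi.single 1 b + Pi.single 3 d + Pi.single 0 a + Pi.single 2 c
      = ![a, b, c, d] := by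
    rw [← single_add_single_four]
    abel
  simp [entry_apply, skewVar_pow_single, Fin.sum_univ_four, mergeWeight, sum_eq,
    Finsupp.single_apply]

end SkewVar

/-! ### Realizations of the diagrams -/

section Matrices

/-- The matrix of two merges. -/
def mergeMat (p s t : ℕ) : Mat [p + s, s + t] [p, s, s, t] :=
  ⟨!![p, s, 0, 0; 0, 0, s, t], by
    constructor
    · intro i; fin_cases i <;> simp [Fin.sum_univ_succ]
    · intro j; fin_cases j <;> simp [Fin.sum_univ_succ]⟩

/-- The matrix of two splits. -/
def splitMat (p s t : ℕ) : Mat [p, s, s, t] [p + s, s + t] :=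
  ⟨!![p, 0; s, 0; 0, s; 0, t], by
    constructor
    · intro i; fin_cases i <;> simp [Fin.sum_univ_succ]
    · intro j; fin_cases j <;> simp [Fin.sum_univ_succ]⟩

/-- The matrix of the crossing of two inner strings. -/
def innerCrossMat (p s t : ℕ) : Mat [p, s, s, t] [p, s, s, t] :=
  ⟨!![p, 0, 0, 0; 0, 0, s, 0; 0, s, 0, 0; 0, 0, 0, t], by
    constructor
    · intro i; fin_cases i <;> simp [Fin.sum_univ_succ]
    · intro j; fin_cases j <;> simp [Fin.sum_univ_succ]⟩

/-- The matrix of the diagram formed by two splits and the crossing of the inner strings. -/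
def crossSplitMat (p s t : ℕ) : Mat [p, s, s, t] [p + s, s + t] :=
  ⟨!![p, 0; 0, s; s, 0; 0, t], by
    constructor
    · intro i; fin_cases i <;> simp [Fin.sum_univ_succ]
    · intro j; fin_cases j <;> simp [Fin.sum_univ_succ]⟩

theorem mergeMat_pad (p s t : ℕ) :
    (mergeMat p s t).pad 4 = !![p, s, 0, 0; 0, 0, s, t; 0, 0, 0, 0; 0, 0, 0, 0] := by
  ext i j; fin_cases i <;> fin_cases j <;> rfl

theorem splitMat_pad (p s t : ℕ) :
    (splitMat p s t).pad 4 = !![p, 0, 0, 0; s, 0, 0, 0; 0, s, 0, 0; 0, t, 0, 0] := by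
  ext i j; fin_cases i <;> fin_cases j <;> rfl

theorem innerCrossMat_pad (p s t : ℕ) :
    (innerCrossMat p s t).pad 4 = !![p, 0, 0, 0; 0, 0, s, 0; 0, s, 0, 0; 0, 0, 0, t] := by
  ext i j; fin_cases i <;> fin_cases j <;> rfl

theorem crossSplitMat_pad (p s t : ℕ) :
    (crossSplitMat p s t).pad 4 = !![p, 0, 0, 0; 0, s, 0, 0; s, 0, 0, 0; 0, t, 0, 0] := by
  ext i j; fin_cases i <;> fin_cases j <;> rfl

end Matrices

section Realizations

theorem realizes_splitArray (p s t : ℕ) :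
    Realizes splitArray (entry ![p, s, s, t] 0) ((splitMat p s t).pad 4) := by
  rw [splitMat_pad]
  refine .of_support isManin_splitArray fun B hB => ?_
  obtain ⟨a, b, c, d, rfl⟩ :
      ∃ a b c d, B = !![a, 0, 0, 0; b, 0, 0, 0; 0, c, 0, 0; 0, d, 0, 0] := by
    refine ⟨B 0 0, B 1 0, B 2 1, B 3 1, ?_⟩
    ext i j
    fin_cases i <;> fin_cases j <;> first | rfl | exact hB _ _ (if_neg (by decide)) rfl
  have monomial_eq : monomial splitArray !![a, 0, 0, 0; b, 0, 0, 0; 0, c, 0, 0; 0, d, 0, 0]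
      = skewVar splitWeight 1 ^ b * skewVar splitWeight 0 ^ a
        * (skewVar splitWeight 3 ^ d * skewVar splitWeight 2 ^ c) := by
    simp [monomial_four, splitArray, halves]
  rw [monomial_eq, entry_splitWeight]
  simp

theorem realizes_mergeArray (p s t : ℕ) :
    Realizes mergeArray (entry ![p, s, s, t] 0) ((mergeMat p s t).pad 4) := by
  rw [mergeMat_pad]
  refine .of_support isManin_mergeArray fun B hB => ?_
  obtain ⟨a, b, c, d, rfl⟩ :
      ∃ a b c d, B = !![a, b, 0, 0; 0, 0, c, d; 0, 0, 0, 0; 0, 0, 0, 0] := by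
    refine ⟨B 0 0, B 0 1, B 1 2, B 1 3, ?_⟩
    ext i j
    fin_cases i <;> fin_cases j <;> first | rfl | exact hB _ _ (if_neg (by decide)) rfl
  have monomial_eq : monomial mergeArray !![a, b, 0, 0; 0, 0, c, d; 0, 0, 0, 0; 0, 0, 0, 0]
      = skewVar mergeWeight 0 ^ a * skewVar mergeWeight 1 ^ b * skewVar mergeWeight 2 ^ c
        * skewVar mergeWeight 3 ^ d := by
    simp [monomial_four, mergeArray, halves]
  rw [monomial_eq, entry_mergeWeight]
  simp [and_assoc]

theorem entry_normal (i j k l : ℕ) :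
    entry 0 0 (number ^ i * raise ^ j * (lower ^ k * number ^ l))
      = if j = 0 ∧ k = 0 then 1 else 0 := by
  rcases j with _ | j
  · rcases k with _ | k
    · simp [← pow_add, entry_number_pow]
    · simpa [pow_succ, mul_assoc] using
        entry_mul_lower_mul_number_pow l (number ^ i * lower ^ k)
  · simpa [pow_succ', mul_assoc] using
      entry_number_pow_mul_raise_mul i (raise ^ j * (lower ^ k * number ^ l))

theorem realizes_oscillator (a b : ℕ) :
    Realizes (graded oscillator)
      (pair (entry 0 0) (MvPolynomial.lcoeff Zq (colSum !![0, a; b, 0]))) !![0, a; b, 0] := by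
  refine realizes_graded isManin_oscillator fun B _ hcol => ?_
  rw [monomial_two]
  refine (entry_normal _ _ _ _).trans (if_congr ?_ rfl rfl)
  simp only [← Matrix.ext_iff, Fin.forall_fin_two, Fin.sum_univ_two, Matrix.of_apply,
    Matrix.cons_val', Matrix.cons_val_fin_one, Matrix.cons_val_zero, Matrix.cons_val_one, zero_add,
    add_zero] at hcol ⊢
  omega

/-- The array that realizes the crossing of the two inner strings among four: a `q`-oscillator
between two one-dimensional blocks. -/
def innerArray : Fin 4 → Fin 4 → Module.End Zq (ℕ →₀ Zq) :=
  !![1, 0, 0, 0; 0, raise, number, 0; 0, number, lower, 0; 0, 0, 0, 1]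

theorem isManin_fin_one {R : Type*} [Ring R] [Algebra Zq R] (a : R) :
    IsManin fun _ _ : Fin 1 => a := by
  constructor <;> simp

theorem isManin_innerArray : IsManin innerArray := by
  have innerArray_eq : innerArray = blockDiag (m := 3) (n := 1)
      (blockDiag (m := 1) (n := 2) (fun _ _ => 1) oscillator) fun _ _ => 1 := by
    funext i j
    fin_cases i <;> fin_cases j <;> rfl
  rw [innerArray_eq]
  exact ((isManin_fin_one 1).blockDiag isManin_oscillator (by simp)).blockDiag (isManin_fin_one 1)
    (by simp)

theorem realizes_innerArray (p s t : ℕ) :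
    Realizes (graded innerArray)
      (pair (entry 0 0) (MvPolynomial.lcoeff Zq (colSum ((innerCrossMat p s t).pad 4))))
      ((innerCrossMat p s t).pad 4) := by
  rw [innerCrossMat_pad]
  refine realizes_graded isManin_innerArray fun B hB hcol => ?_
  obtain ⟨a, b, c, d, e, f, rfl⟩ :
      ∃ a b c d e f, B = !![a, 0, 0, 0; 0, b, c, 0; 0, d, e, 0; 0, 0, 0, f] := by
    refine ⟨B 0 0, B 1 1, B 1 2, B 2 1, B 2 2, B 3 3, ?_⟩
    ext i j
    fin_cases i <;> fin_cases j <;> first | rfl | exact hB _ _ rfl rfl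
  have monomial_eq : monomial innerArray !![a, 0, 0, 0; 0, b, c, 0; 0, d, e, 0; 0, 0, 0, f]
      = number ^ d * raise ^ b * (lower ^ e * number ^ c) := by
    rw [monomial_four]
    simp [innerArray]
  rw [monomial_eq, entry_normal]
  refine if_congr ?_ rfl rfl
  simp only [Fin.forall_fin_succ, Fin.sum_univ_succ, Matrix.of_apply, Matrix.cons_val',
    Matrix.cons_val_fin_one, Matrix.cons_val_zero, Matrix.cons_val_succ, Finset.univ_unique,
    Fin.default_eq_zero, Finset.sum_const, Finset.card_singleton, smul_eq_mul, one_mul, zero_add,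
    add_zero, forall_const, EmbeddingLike.apply_eq_iff_eq, Matrix.vecCons_inj, and_true,
    true_and] at hcol ⊢
  omega

end Realizations

section Strand

/-- The tensor product of two algebras, as a module through their ring structures. For concrete
algebras, `⊗` would pick up module instances that are not syntactically those of the ring. -/
abbrev RingTensor (R S : Type*) [Ring R] [Ring S] [Algebra Zq R] [Algebra Zq S] : Type _ :=
  R ⊗[Zq] S

/-- The algebra in which the crossing of the inner strings above two splits is realized: the tensor
product of the algebras acting on the `q`-oscillator, recording column sums, and containing the
skew variables of the splits. -/
abbrev StrandAlgebra : Type :=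
  RingTensor (RingTensor (Module.End Zq (ℕ →₀ Zq)) (MvPolynomial (Fin 4) Zq))
    (Module.End Zq ((Fin 4 → ℕ) →₀ Zq))

/-- An operator `T` of the `q`-oscillator acting on the `j`-th of four strings, together with the
variable recording the `j`-th column sum and the skew variable of the `j`-th part of a split. -/
def strand (T : Module.End Zq (ℕ →₀ Zq)) (j : Fin 4) : StrandAlgebra :=
  (T ⊗ₜ MvPolynomial.X j) ⊗ₜ skewVar splitWeight j

theorem tensorMul_innerArray_splitArray :
    tensorMul (graded innerArray) splitArray = Matrix.of.symm !![strand 1 0, 0, 0, 0;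
      strand raise 1, strand number 2, 0, 0; strand number 1, strand lower 2, 0, 0;
      0, strand 1 3, 0, 0] := by
  funext i j
  fin_cases i <;> fin_cases j <;>
    simp [tensorMul, graded, innerArray, splitArray, halves, strand, Fin.sum_univ_four]

/-- The functional for the crossing of the inner strings above two splits. -/
def strandFunctional (p s t : ℕ) : StrandAlgebra →ₗ[Zq] Zq :=
  pair (pair (entry 0 0) (MvPolynomial.lcoeff Zq (colSum ((innerCrossMat p s t).pad 4))))
    (entry ![p, s, s, t] 0)

theorem strand_pow (T : Module.End Zq (ℕ →₀ Zq)) (j : Fin 4) (m : ℕ) :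
    strand T j ^ m = ((T ^ m) ⊗ₜ (MvPolynomial.X j ^ m)) ⊗ₜ (skewVar splitWeight j ^ m) := by
  simp only [strand, Algebra.TensorProduct.tmul_pow]

theorem strandFunctional_tmul (p s t : ℕ) (T : Module.End Zq (ℕ →₀ Zq)) (a b c d : ℕ) :
    strandFunctional p s t ((T ⊗ₜ (MvPolynomial.X 1 ^ b * MvPolynomial.X 0 ^ a
        * (MvPolynomial.X 3 ^ d * MvPolynomial.X 2 ^ c))) ⊗ₜ (skewVar splitWeight 1 ^ b
        * skewVar splitWeight 0 ^ a * (skewVar splitWeight 3 ^ d * skewVar splitWeight 2 ^ c)))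
      = if ![a, b, c, d] = ![p, s, s, t] then entry 0 0 T else 0 := by
  rw [strandFunctional, pair_tmul, pair_tmul, entry_splitWeight]
  by_cases h : ![a, b, c, d] = ![p, s, s, t]
  · obtain ⟨rfl, rfl, hc, rfl⟩ : p = a ∧ s = b ∧ s = c ∧ t = d := by simpa [eq_comm] using h
    have prod_eq : ∏ j, MvPolynomial.X j ^ ∑ i, (innerCrossMat p s t).pad 4 i j
        = (MvPolynomial.X 1 ^ s * MvPolynomial.X 0 ^ p
          * (MvPolynomial.X 3 ^ t * MvPolynomial.X 2 ^ s) : MvPolynomial (Fin 4) Zq) := by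
      simp only [innerCrossMat_pad, Matrix.of_apply, Matrix.cons_val', Matrix.cons_val_fin_one,
        Fin.sum_univ_four, Matrix.cons_val_zero, Matrix.cons_val_one, Matrix.cons_val,
        Fin.prod_univ_four, add_zero, zero_add]
      ring
    rw [if_pos h, if_pos h, ← hc, ← prod_eq, lcoeff_colSum, mul_one, mul_one]
  · rw [if_neg h, if_neg h, mul_zero]

theorem strandFunctional_mul (p s t a b c d e f : ℕ) :
    strandFunctional p s t (strand number 1 ^ c * strand raise 1 ^ b * strand 1 0 ^ a
        * (strand 1 3 ^ f * strand lower 2 ^ e * strand number 2 ^ d))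
      = if ![a, c + b, e + d, f] = ![p, s, s, t] ∧ b = 0 ∧ e = 0 then 1 else 0 := by
  have mul_eq : strand number 1 ^ c * strand raise 1 ^ b * strand 1 0 ^ a
        * (strand 1 3 ^ f * strand lower 2 ^ e * strand number 2 ^ d)
      = ((number ^ c * raise ^ b * (lower ^ e * number ^ d)) ⊗ₜ
          (MvPolynomial.X 1 ^ (c + b) * MvPolynomial.X 0 ^ a
            * (MvPolynomial.X 3 ^ f * MvPolynomial.X 2 ^ (e + d)))) ⊗ₜ
        (skewVar splitWeight 1 ^ (c + b) * skewVar splitWeight 0 ^ a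
          * (skewVar splitWeight 3 ^ f * skewVar splitWeight 2 ^ (e + d))) := by
    simp only [strand_pow, Algebra.TensorProduct.tmul_mul_tmul, one_pow, mul_one, one_mul, pow_add,
      mul_assoc]
  rw [mul_eq, strandFunctional_tmul, entry_normal, ← ite_and]

theorem realizes_crossSplit (p s t : ℕ) :
    Realizes (tensorMul (graded innerArray) splitArray) (strandFunctional p s t)
      ((crossSplitMat p s t).pad 4) := by
  rw [crossSplitMat_pad]
  refine .of_support ((realizes_innerArray p s t).isManin.tensorMul isManin_splitArray)
    fun B hB => ?_
  rw [tensorMul_innerArray_splitArray] at hB ⊢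
  obtain ⟨a, b, c, d, e, f, rfl⟩ :
      ∃ a b c d e f, B = !![a, 0, 0, 0; b, d, 0, 0; c, e, 0, 0; 0, f, 0, 0] := by
    refine ⟨B 0 0, B 1 0, B 2 0, B 1 1, B 2 1, B 3 1, ?_⟩
    ext i j
    fin_cases i <;> fin_cases j <;> first | rfl | exact hB _ _ rfl rfl
  have map_eq := strandFunctional_mul p s t a b c d e f
  rw [monomial_four]
  simp only [Matrix.of_symm_apply, Matrix.of_apply, Matrix.cons_val', Matrix.cons_val_fin_one,
    Matrix.cons_val_zero, Matrix.cons_val_one, Matrix.cons_val, pow_zero, mul_one, one_mul]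
  refine map_eq.trans (if_congr ?_ rfl rfl)
  simp only [Matrix.vecCons_inj, and_true, EmbeddingLike.apply_eq_iff_eq, true_and]
  omega

theorem tensorMul_mergeArray {R : Type*} [Ring R] [Algebra Zq R] (a b c d e f : R) :
    tensorMul mergeArray (Matrix.of.symm !![a, 0, 0, 0; b, d, 0, 0; c, e, 0, 0; 0, f, 0, 0])
      = Matrix.of.symm !![
        skewVar mergeWeight 0 ⊗ₜ a + skewVar mergeWeight 1 ⊗ₜ b, skewVar mergeWeight 1 ⊗ₜ d, 0, 0;
        skewVar mergeWeight 2 ⊗ₜ c, skewVar mergeWeight 3 ⊗ₜ f + skewVar mergeWeight 2 ⊗ₜ e, 0, 0;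
        0, 0, 0, 0; 0, 0, 0, 0] := by
  funext i j
  fin_cases i <;> fin_cases j <;>
    simp [tensorMul, mergeArray, halves, Fin.sum_univ_four, add_comm]

theorem strandFunctional_number_pow_mul_raise_mul (p s t m n : ℕ) (w : StrandAlgebra) :
    strandFunctional p s t (strand number 1 ^ m * strand 1 0 ^ n * strand raise 1 * w) = 0 := by
  have mul_eq : strand number 1 ^ m * strand 1 0 ^ n * strand raise 1
      = ((number ^ m * raise) ⊗ₜ (MvPolynomial.X 1 ^ m * MvPolynomial.X 0 ^ n * MvPolynomial.X 1))
        ⊗ₜ (skewVar splitWeight 1 ^ m * skewVar splitWeight 0 ^ n * skewVar splitWeight 1) := by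
    rw [strand_pow, strand_pow, strand]
    simp only [Algebra.TensorProduct.tmul_mul_tmul, one_pow, mul_one]
  rw [mul_eq]
  exact pair_tmul_mul_eq_zero_of_left
    (pair_tmul_mul_eq_zero_of_left (entry_number_pow_mul_raise_mul m) _ _) _ _ w

theorem strandFunctional_mul_lower_mul_number_pow (p s t m n : ℕ) (w : StrandAlgebra) :
    strandFunctional p s t (w * (strand lower 2 * strand 1 3 ^ n * strand number 2 ^ m)) = 0 := by
  have mul_eq : strand lower 2 * strand 1 3 ^ n * strand number 2 ^ m
      = ((lower * number ^ m) ⊗ₜ (MvPolynomial.X 2 * MvPolynomial.X 3 ^ n * MvPolynomial.X 2 ^ m))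
        ⊗ₜ (skewVar splitWeight 2 * skewVar splitWeight 3 ^ n * skewVar splitWeight 2 ^ m) := by
    rw [strand_pow, strand_pow, strand]
    simp only [Algebra.TensorProduct.tmul_mul_tmul, one_pow, mul_one]
  rw [mul_eq]
  exact pair_mul_tmul_eq_zero_of_left
    (pair_mul_tmul_eq_zero_of_left (entry_mul_lower_mul_number_pow m) _ _) _ _ w

/-- The functional for the double coset diagram. -/
def diagramFunctional (p s t : ℕ) :
    RingTensor (Module.End Zq ((Fin 4 → ℕ) →₀ Zq)) StrandAlgebra →ₗ[Zq] Zq :=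
  pair (entry ![p, s, s, t] 0) (strandFunctional p s t)

theorem diagramFunctional_mul_add (p s t a b c d : ℕ) :
    diagramFunctional p s t ((skewVar mergeWeight 2 ⊗ₜ strand number 1) ^ c
      * (skewVar mergeWeight 0 ⊗ₜ strand 1 0 + skewVar mergeWeight 1 ⊗ₜ strand raise 1) ^ a
      * ((skewVar mergeWeight 3 ⊗ₜ strand 1 3 + skewVar mergeWeight 2 ⊗ₜ strand lower 2) ^ d
        * (skewVar mergeWeight 1 ⊗ₜ strand number 2) ^ b))
      = diagramFunctional p s t ((skewVar mergeWeight 2 ⊗ₜ strand number 1) ^ c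
        * (skewVar mergeWeight 0 ⊗ₜ strand 1 0) ^ a
        * ((skewVar mergeWeight 3 ⊗ₜ strand 1 3) ^ d
          * (skewVar mergeWeight 1 ⊗ₜ strand number 2) ^ b)) := by
  rw [map_mul_add_pow_mul, map_mul_add_pow_mul']
  · intro m w
    simp only [Algebra.TensorProduct.tmul_pow, Algebra.TensorProduct.tmul_mul_tmul]
    exact pair_mul_tmul_eq_zero_of_right
      (strandFunctional_mul_lower_mul_number_pow p s t b m) _ _ w
  · intro m w
    simp only [Algebra.TensorProduct.tmul_pow, Algebra.TensorProduct.tmul_mul_tmul]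
    exact pair_tmul_mul_eq_zero_of_right
      (strandFunctional_number_pow_mul_raise_mul p s t c m) _ _ w

theorem diagramFunctional_mul (p s t a b c d : ℕ) :
    diagramFunctional p s t ((skewVar mergeWeight 2 ⊗ₜ strand number 1) ^ c
        * (skewVar mergeWeight 0 ⊗ₜ strand 1 0) ^ a
        * ((skewVar mergeWeight 3 ⊗ₜ strand 1 3) ^ d
          * (skewVar mergeWeight 1 ⊗ₜ strand number 2) ^ b))
      = if ![a, b, c, d] = ![p, s, s, t] then 1 else 0 := by
  have map_strand : strandFunctional p s t (strand number 1 ^ c * strand 1 0 ^ a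
      * (strand 1 3 ^ d * strand number 2 ^ b))
      = if ![a, c, b, d] = ![p, s, s, t] then 1 else 0 := by
    simpa only [pow_zero, mul_one, add_zero, zero_add, and_true] using
      strandFunctional_mul p s t a 0 c b 0 d
  simp only [Algebra.TensorProduct.tmul_pow, Algebra.TensorProduct.tmul_mul_tmul]
  rw [diagramFunctional, pair_tmul, map_strand, entry_mergeWeight_interleaved, ite_mul, one_mul,
    zero_mul, ← ite_and]
  refine if_congr ?_ rfl rfl
  simp only [Matrix.vecCons_inj, and_true, and_iff_left_iff_imp, and_imp]
  omega

theorem realizes_crossDiagram (p s t : ℕ) :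
    Realizes (tensorMul mergeArray (tensorMul (graded innerArray) splitArray))
      (diagramFunctional p s t) !![p, s, 0, 0; s, t, 0, 0; 0, 0, 0, 0; 0, 0, 0, 0] := by
  refine .of_support (isManin_mergeArray.tensorMul (realizes_crossSplit p s t).isManin)
    fun B hB => ?_
  rw [tensorMul_innerArray_splitArray, tensorMul_mergeArray] at hB ⊢
  obtain ⟨a, b, c, d, rfl⟩ :
      ∃ a b c d, B = !![a, b, 0, 0; c, d, 0, 0; 0, 0, 0, 0; 0, 0, 0, 0] := by
    refine ⟨B 0 0, B 0 1, B 1 0, B 1 1, ?_⟩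
    ext i j
    fin_cases i <;> fin_cases j <;> first | rfl | exact hB _ _ rfl rfl
  rw [monomial_four]
  simp only [Matrix.of_symm_apply, Matrix.of_apply, Matrix.cons_val', Matrix.cons_val_fin_one,
    Matrix.cons_val_zero, Matrix.cons_val_one, Matrix.cons_val, pow_zero, mul_one, one_mul]
  refine ((diagramFunctional_mul_add p s t a b c d).trans
    (diagramFunctional_mul p s t a b c d)).trans (if_congr ?_ rfl rfl)
  simp [and_assoc]

end Strand

/-! ### The product of two crossings -/

section Crossing

theorem pair_monomial_tensorMul_two {R S : Type*} [Ring R] [Ring S] [Algebra Zq R] [Algebra Zq S]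
    (x : Fin 2 → Fin 2 → R) (y : Fin 2 → Fin 2 → S) (f : R →ₗ[Zq] Zq) {g : S →ₗ[Zq] Zq}
    (hleft : ∀ m w, g (y 1 0 ^ m * y 0 0 * w) = 0)
    (hright : ∀ m w, g (w * (y 1 1 * y 0 1 ^ m)) = 0) (C : Matrix (Fin 2) (Fin 2) ℕ) :
    pair f g (monomial (tensorMul x y) C)
      = f (x 1 1 ^ C 1 0 * x 0 1 ^ C 0 0 * (x 1 0 ^ C 1 1 * x 0 0 ^ C 0 1))
        * g (y 1 0 ^ (C 1 0 + C 0 0) * y 0 1 ^ (C 1 1 + C 0 1)) := by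
  have kill_left : ∀ (u v r : R) (k m : ℕ) (w : R ⊗[Zq] S),
      pair f g ((u ⊗ₜ (y 1 0 ^ k)) * (v ⊗ₜ y 1 0) ^ m * (r ⊗ₜ y 0 0) * w) = 0 := by
    intro u v r k m w
    rw [Algebra.TensorProduct.tmul_pow, Algebra.TensorProduct.tmul_mul_tmul,
      Algebra.TensorProduct.tmul_mul_tmul, ← pow_add]
    exact pair_tmul_mul_eq_zero_of_right (hleft _) _ _ w
  have kill_right : ∀ (u v r : R) (k m : ℕ) (w : R ⊗[Zq] S),
      pair f g (w * ((r ⊗ₜ y 1 1) * (v ⊗ₜ y 0 1) ^ m * (u ⊗ₜ (y 0 1 ^ k)))) = 0 := by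
    intro u v r k m w
    rw [Algebra.TensorProduct.tmul_pow, Algebra.TensorProduct.tmul_mul_tmul,
      Algebra.TensorProduct.tmul_mul_tmul, mul_assoc (y 1 1), ← pow_add]
    exact pair_mul_tmul_eq_zero_of_right (hright _) _ _ w
  have z_eq : ∀ i k, tensorMul x y i k = x i 0 ⊗ₜ y 0 k + x i 1 ⊗ₜ y 1 k := fun i k =>
    Fin.sum_univ_two _
  have drop_10 := map_mul_add_pow_mul (kill_left 1 (x 1 1) (x 1 0) 0)
  have drop_00 := map_mul_add_pow_mul (kill_left (x 1 1 ^ C 1 0) (x 0 1) (x 0 0) (C 1 0))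
  have drop_01 := map_mul_add_pow_mul' (kill_right 1 (x 0 0) (x 0 1) 0)
  have drop_11 := map_mul_add_pow_mul' (kill_right (x 0 0 ^ C 0 1) (x 1 0) (x 1 1) (C 0 1))
  simp only [pow_zero, ← Algebra.TensorProduct.one_def, one_mul, mul_one] at drop_10 drop_01
  simp only [← Algebra.TensorProduct.tmul_pow] at drop_00 drop_11
  rw [monomial_two, z_eq, z_eq, z_eq, z_eq, add_comm (x 1 0 ⊗ₜ y 0 0), add_comm (x 0 0 ⊗ₜ y 0 0),
    mul_assoc, drop_10, ← mul_assoc, drop_00, ← mul_assoc, drop_01, mul_assoc, drop_11]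
  simp only [Algebra.TensorProduct.tmul_pow, Algebra.TensorProduct.tmul_mul_tmul, pair_tmul,
    pow_add]

theorem lcoeff_colSum_antidiagonal (a b : ℕ) :
    MvPolynomial.lcoeff Zq (colSum !![0, a; b, 0]) (MvPolynomial.X 0 ^ b * MvPolynomial.X 1 ^ a)
      = 1 := by
  simpa only [Fin.prod_univ_two, Fin.sum_univ_two, Matrix.of_apply, Matrix.cons_val',
    Matrix.cons_val_fin_one, Matrix.cons_val_zero, Matrix.cons_val_one, zero_add, add_zero]
    using lcoeff_colSum !![0, a; b, 0]

theorem structConst_crossing (s c d : ℕ) :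
    structConst !![0, c + s; s + d, 0] !![0, s + d; c + s, 0] !![c, s; s, d]
      = qpow (-((s : ℤ) * (s - 1) / 2) - s * (c + d)) * (qpow (-1) - qpow 1) ^ s
        * qFactorial s := by
  rw [structConst_eq (realizes_oscillator _ _) (realizes_oscillator _ _),
    pair_monomial_tensorMul_two]
  · have left_eq : graded oscillator 1 1 ^ s * graded oscillator 0 1 ^ c
          * (graded oscillator 1 0 ^ d * graded oscillator 0 0 ^ s)
        = (lower ^ s * number ^ (c + d) * raise ^ s)
          ⊗ₜ (MvPolynomial.X 0 ^ (s + d) * MvPolynomial.X 1 ^ (c + s)) := by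
      simp only [graded, Algebra.TensorProduct.tmul_pow, Algebra.TensorProduct.tmul_mul_tmul]
      congr 1
      · simp only [pow_add, mul_assoc]; rfl
      · ring
    have right_eq : graded oscillator 1 0 ^ (s + c) * graded oscillator 0 1 ^ (d + s)
        = (number ^ (s + c + (d + s)))
          ⊗ₜ (MvPolynomial.X 0 ^ (c + s) * MvPolynomial.X 1 ^ (s + d)) := by
      simp only [graded, Algebra.TensorProduct.tmul_pow, Algebra.TensorProduct.tmul_mul_tmul]
      congr 1
      · exact (pow_add _ _ _).symm
      · ring
    simp only [Matrix.of_apply, Matrix.cons_val', Matrix.cons_val_fin_one, Matrix.cons_val_zero,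
      Matrix.cons_val_one]
    rw [left_eq, right_eq, pair_tmul, pair_tmul, lcoeff_colSum_antidiagonal,
      lcoeff_colSum_antidiagonal, entry_antinormal, entry_number_pow, mul_one, mul_one, mul_one,
      Nat.cast_add]
  · intro m w
    simp only [graded, Algebra.TensorProduct.tmul_pow, Algebra.TensorProduct.tmul_mul_tmul]
    exact pair_tmul_mul_eq_zero_of_left (entry_number_pow_mul_raise_mul m) _ _ w
  · intro m w
    simp only [graded, Algebra.TensorProduct.tmul_pow, Algebra.TensorProduct.tmul_mul_tmul]
    exact pair_mul_tmul_eq_zero_of_left (entry_mul_lower_mul_number_pow m) _ _ w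

end Crossing

/-! ### Diagrams in the `q`-Schur category -/

section Category

theorem star_xi {lam mu sig rho : List ℕ} (A : Mat lam mu) (B : Mat sig rho) :
    star (xi A) (xi B) = xi (A.diag B) := by
  rw [star, xi, xi, Finsupp.sum_single_index, Finsupp.sum_single_index, mul_one, one_smul]
  · rw [mul_zero, zero_smul]
  · rw [Finsupp.sum_single_index] <;> rw [zero_mul, zero_smul]

theorem Mat.pad_two {a b c d : ℕ} (A : Mat [a, b] [c, d]) : A.pad 2 = A.1 := by
  funext i j
  exact dif_pos ⟨i.2, j.2⟩

theorem star_merge (p s t : ℕ) :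
    (star (merge p s (p + s) rfl) (merge s t (s + t) rfl) : Hom [p, s, s, t] [p + s, s + t])
      = xi (mergeMat p s t) :=
  (star_xi _ _).trans (congrArg xi (Subtype.ext (by
    funext i j; fin_cases i <;> fin_cases j <;> rfl)))

theorem star_split (p s t : ℕ) :
    (star (split p s (p + s) rfl) (split s t (s + t) rfl) : Hom [p + s, s + t] [p, s, s, t])
      = xi (splitMat p s t) :=
  (star_xi _ _).trans (congrArg xi (Subtype.ext (by
    funext i j; fin_cases i <;> fin_cases j <;> rfl)))

theorem star_crossing (p s t : ℕ) :
    (star (idHom [p]) (star (crossing s s) (idHom [t])) : Hom [p, s, s, t] [p, s, s, t])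
      = xi (innerCrossMat p s t) :=
  (congrArg (star _) (star_xi _ _)).trans ((star_xi _ _).trans (congrArg xi (Subtype.ext (by
    funext i j; fin_cases i <;> fin_cases j <;> rfl))))

theorem innerCross_comp_split (p s t : ℕ) :
    comp (xi (innerCrossMat p s t)) (xi (splitMat p s t)) = xi (crossSplitMat p s t) :=
  comp_xi_eq_xi rfl (realizes_innerArray p s t) (realizes_splitArray p s t)
    (realizes_crossSplit p s t)

theorem merge_comp_crossSplit (p s t : ℕ) {C : Mat [p + s, s + t] [p + s, s + t]}
    (hC : C.1 = !![p, s; s, t]) :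
    comp (xi (mergeMat p s t)) (xi (crossSplitMat p s t)) = xi C := by
  have pad_eq : C.pad 4 = !![p, s, 0, 0; s, t, 0, 0; 0, 0, 0, 0; 0, 0, 0, 0] := by
    obtain ⟨_, hrow, hcol⟩ := C
    subst hC
    ext i j
    fin_cases i <;> fin_cases j <;> rfl
  exact comp_xi_eq_xi rfl (realizes_mergeArray p s t) (realizes_crossSplit p s t)
    (pad_eq ▸ realizes_crossDiagram p s t)

theorem crossDiagram_eq_xi (a b s : ℕ) (h : s ≤ min a b) :
    crossDiagram a b s h = xi (crossMat a b s h) := by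
  have diagram_eq : ∀ (p t : ℕ) (hp : p + s = a) (ht : s + t = b),
      comp (lam := [a, b]) (mu := [p, s, s, t]) (nu := [a, b])
        (star (merge p s a hp) (merge s t b ht))
        (comp (lam := [p, s, s, t]) (mu := [p, s, s, t]) (nu := [a, b])
          (star (idHom [p]) (star (crossing s s) (idHom [t])))
          (star (split p s a hp) (split s t b ht)))
      = xi (crossMat a b s h) := by
    rintro p t rfl rfl
    refine (congrArg₂ comp (star_merge p s t) ((congrArg₂ comp (star_crossing p s t)
      (star_split p s t)).trans (innerCross_comp_split p s t))).trans
        (merge_comp_crossSplit p s t ?_)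
    change !![p + s - s, s; s, s + t - s] = _
    rw [Nat.add_sub_cancel, Nat.add_sub_cancel_left]
  exact diagram_eq _ _ _ _

theorem crossMat_bijective (a b : ℕ) : Function.Bijective fun s : Fin (min a b + 1) =>
    crossMat a b s (Nat.le_of_lt_succ s.isLt) := by
  constructor
  · intro s s' h
    exact Fin.ext (congrFun (congrFun (congrArg Subtype.val h) 0) 1)
  · rintro ⟨C, hrow, hcol⟩
    change Matrix (Fin 2) (Fin 2) ℕ at C
    have row_zero : ∑ j : Fin 2, C 0 j = a := hrow 0
    have row_one : ∑ j : Fin 2, C 1 j = b := hrow 1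
    have col_zero : ∑ i : Fin 2, C i 0 = a := hcol 0
    rw [Fin.sum_univ_two] at row_zero row_one col_zero
    refine ⟨⟨C 0 1, by omega⟩, Subtype.ext ?_⟩
    have entry_zero_zero : a - C 0 1 = C 0 0 := by omega
    have entry_one_zero : C 1 0 = C 0 1 := by omega
    have entry_one_one : b - C 0 1 = C 1 1 := by omega
    refine Eq.trans ?_ (Matrix.eta_fin_two C).symm
    change !![a - C 0 1, C 0 1; C 0 1, b - C 0 1] = _
    rw [entry_zero_zero, entry_one_zero, entry_one_one]

theorem Z_crossing (a b s : ℕ) (h : s ≤ min a b) {A : Mat [a, b] [b, a]} {B : Mat [b, a] [a, b]}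
    (hA : A.1 = !![0, a; b, 0]) (hB : B.1 = !![0, b; a, 0]) :
    Z A B (crossMat a b s h)
      = qpow (-((s : ℤ) * (s - 1) / 2) - s * (a + b - 2 * s))
        * (qpow (-1) - qpow 1) ^ s * qFactorial s := by
  change structConst (n := 2) (A.pad 2) (B.pad 2) (Mat.pad _ 2) = _
  rw [Mat.pad_two, Mat.pad_two, Mat.pad_two, hA, hB]
  obtain ⟨c, rfl⟩ : ∃ c, a = c + s := ⟨a - s, by omega⟩
  obtain ⟨d, rfl⟩ : ∃ d, b = s + d := ⟨b - s, by omega⟩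
  have exponent_eq : ((c + s : ℕ) + (s + d : ℕ) - 2 * s : ℤ) = c + d := by
    push_cast
    ring
  change structConst _ _ !![c + s - s, s; s, s + d - s] = _
  rw [Nat.add_sub_cancel, Nat.add_sub_cancel_left, structConst_crossing, exponent_eq]

theorem crossing_comp_crossing (a b : ℕ) :
    comp (crossing b a) (crossing a b)
      = ∑ s : Fin (min a b + 1),
          (qpow (-((s : ℤ) * ((s : ℤ) - 1) / 2) - (s : ℤ) * ((a : ℤ) + (b : ℤ) - 2 * (s : ℤ)))
              * (qpow (-1) - qpow 1) ^ (s : ℕ) * qFactorial s)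
            • xi (crossMat a b s (Nat.le_of_lt_succ s.isLt)) := by
  refine (comp_xi _ _).trans ?_
  rw [← (crossMat_bijective a b).sum_comp]
  exact Finset.sum_congr rfl fun s _ => congrArg (· • _) (Z_crossing _ _ _ _ rfl rfl)

end Category

end QSchur

end

theorem corollary1984 (a b : ℕ) :
    QSchur.comp (QSchur.crossing b a) (QSchur.crossing a b)
      = ∑ s : Fin (min a b + 1),
          (QSchur.qpow (-((s : ℤ) * ((s : ℤ) - 1) / 2) - (s : ℤ) * ((a : ℤ) + (b : ℤ) - 2 * (s : ℤ)))
              * (QSchur.qpow (-1) - QSchur.qpow 1) ^ (s : ℕ) * QSchur.qFactorial s)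
            • QSchur.crossDiagram a b s (Nat.le_of_lt_succ s.isLt)
    ∧ ∀ (s : ℕ) (hs : s ≤ min a b),
        QSchur.crossDiagram a b s hs = QSchur.xi (QSchur.crossMat a b s hs) := by
  refine ⟨?_, QSchur.crossDiagram_eq_xi a b⟩
  simp only [QSchur.crossDiagram_eq_xi]
  exact QSchur.crossing_comp_crossing a b
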